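/- **Setting.** Let $\tau:E\to Q$ and $\tau':E'\to Q'$ be Lie algebroids with anchors $\rho,\rho'$ and differentials $d^E,d^{E'}$, over smooth finite-dimensional (Hausdorff, second countable) manifolds. Let $\Omega\in\Gamma(\wedge^2E^*)$, $\alpha\in\Gamma(E^*)$ satisfy $d^E\Omega=0$, $d^E\alpha=0$, and likewise let $\Omega'\in\Gamma(\wedge^2(E')^*)$, $\alpha'\in\Gamma((E')^*)$ be $d^{E'}$-closed. For a subspace $F\subseteq E_x$ put $F^\perp=\{e\in E_x : \Omega(x)(e,f)=0 \text{ for all } f\in F\}$. The constraint algorithm of $(E,\Omega,\alpha)$ is the sequence $Q_0=Q$, $$Q_{k+1}=\{x\in Q_k : \alpha(x)(e)=0\ \text{ for all } e\in(\rho^{-1}(T_xQ_k))^\perp\},\qquad E_k=\rho^{-1}(TQ_k),$$ with $(E_k)_x=\rho^{-1}(T_xQ_k)$ for $x\in Q_k$; $Q'_k$, $E'_k$ are defined in the same way from $(E',\Omega',\alpha')$. Assume that, for every $k$, $Q_k$ and $Q'_k$ are embedded submanifolds and $E_k\to Q_k$, $E'_k\to Q'_k$ are Lie subalgebroids of $E$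 and $E'$ (vector bundles with a Lie algebroid structure for which the inclusion is a Lie algebroid morphism), and write $\Omega_k,\alpha_k,\Omega'_k,\alpha'_k$ for the restrictions. A Lie algebroid morphism is a smooth vector bundle morphism $(F,f)$ with $d^E((F,f)^*\phi')=(F,f)^*(d^{E'}\phi')$ for all $\phi'\in\Gamma(\wedge^j(E')^*)$ and all $j$. A pair $(\Pi,\pi)$, $\Pi:E\to E'$ over $\pi:Q\to Q'$, is a dynamical Lie algebroid epimorphism from $(E,\Omega,\alpha)$ to $(E',\Omega',\alpha')$ if it is a Lie algebroid morphism, $\pi$ is a surjective submersion, every $\Pi_{|E_x}:E_x\to E'_{\pi(x)}$ is surjective, $(\Pi,\pi)^*\Omega'=\Omega$ and $(\Pi,\pi)^*\alpha'=\alpha$. **Theorem 3.2.** Let $(\Pi,\pi)$ be a dynamical Lie algebroid epimorphism from $(E,\Omega,\alpha)$ to $(E',\Omega',\alpha')$. Then for every $k\ge 0$: 1. $\pi(Q_k)=Q'_k$ and $\Pi(E_k)=E'_k$. 2. If $x\in Q_k$, then $\pi^{-1}(\pi(x))\subseteq Q_k$ and $\ker(\Pi_{|E_x})\subseteq (E_k)_x$.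 3. $\Omega_k,\alpha_k$ and $\Omega'_k,\alpha'_k$ are closed, and the restrictions $\pi_k:Q_k\to Q'_k$, $\Pi_k:E_k\to E'_k$ form a dynamical Lie algebroid epimorphism $(\Pi_k,\pi_k)$ from $(E_k,\Omega_k,\alpha_k)$ to $(E'_k,\Omega'_k,\alpha'_k)$. Moreover, for every $k\ge0$: 4. $Q_k=Q_{k+1}$ if and only if $Q'_k=Q'_{k+1}$. 5. If $X\in\Gamma(E_k)$ and $X'\in\Gamma(E'_k)$ satisfy $X'\circ\pi_k=\Pi_k\circ X$, then $i_X\Omega_{|Q_k}=\alpha_{|Q_k}$ (as an equality in $E_x^*$ for each $x\in Q_k$) if and only if $i_{X'}\Omega'_{|Q'_k}=\alpha'_{|Q'_k}$. Every $X'\in\Gamma(E'_k)$ with $i_{X'}\Omega'_{|Q'_k}=\alpha'_{|Q'_k}$ has a lift $X\in\Gamma(E_k)$, that is, $X'\circ\pi_k=\Pi_k\circ X$, with $i_X\Omega_{|Q_k}=\alpha_{|Q_k}$. -/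

import Mathlib

open Bundle (TotalSpace)
open Set
open scoped Manifold ContDiff

noncomputable section

section Algebroid

/-- Smooth (global) sections of a rank `n` vector bundle `E` over an `m`-dimensional manifold. -/
abbrev Sec (m n : ℕ) {Q : Type*} [TopologicalSpace Q] [ChartedSpace (EuclideanSpace ℝ (Fin m)) Q]
    (E : Q → Type*) [TopologicalSpace (TotalSpace (EuclideanSpace ℝ (Fin n)) E)]
    [∀ x, TopologicalSpace (E x)] [FiberBundle (EuclideanSpace ℝ (Fin n)) E] :=
  Cₛ^∞⟮𝓡 m; EuclideanSpace ℝ (Fin n), E⟯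

/-- The derivative `v(f)` of a real function `f` in the direction of a tangent vector `v`. -/
def derivAlong {m : ℕ} {Q : Type*} [TopologicalSpace Q]
    [ChartedSpace (EuclideanSpace ℝ (Fin m)) Q] (f : Q → ℝ) {x : Q}
    (v : TangentSpace (𝓡 m) x) : ℝ :=
  mfderiv (𝓡 m) 𝓘(ℝ, ℝ) f x v

/-- A Lie algebroid structure on a rank `n` vector bundle `E` over an `m`-dimensional manifold `Q`:
a smooth bundle map (the anchor) from `E` to the tangent bundle and a real Lie bracket on the
smooth sections of `E` satisfying the Leibniz rule. -/
structure LieAlgebroid (m n : ℕ) {Q : Type*} [TopologicalSpace Q]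
    [ChartedSpace (EuclideanSpace ℝ (Fin m)) Q] [IsManifold (𝓡 m) ∞ Q]
    (E : Q → Type*) [∀ x, AddCommGroup (E x)] [∀ x, Module ℝ (E x)]
    [∀ x, TopologicalSpace (E x)] [TopologicalSpace (TotalSpace (EuclideanSpace ℝ (Fin n)) E)]
    [FiberBundle (EuclideanSpace ℝ (Fin n)) E] [VectorBundle ℝ (EuclideanSpace ℝ (Fin n)) E] where
  /-- the anchor map -/
  anchor : ∀ x, E x →ₗ[ℝ] TangentSpace (𝓡 m) x
  contMDiff_anchor :
    ContMDiff ((𝓡 m).prod 𝓘(ℝ, EuclideanSpace ℝ (Fin n))) (𝓡 m).tangent ∞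
      (fun p : TotalSpace (EuclideanSpace ℝ (Fin n)) E =>
        (⟨p.1, anchor p.1 p.2⟩ : TangentBundle (𝓡 m) Q))
  /-- the bracket of sections -/
  bracket : Sec m n E →ₗ[ℝ] Sec m n E →ₗ[ℝ] Sec m n E
  bracket_self : ∀ X, bracket X X = 0
  jacobi : ∀ X Y Z, bracket X (bracket Y Z) + bracket Y (bracket Z X) + bracket Z (bracket X Y) = 0
  leibniz : ∀ (X Y : Sec m n E) (f : Q → ℝ) (hf : ContMDiff (𝓡 m) 𝓘(ℝ, ℝ) ∞ f) (x : Q),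
    bracket X ⟨fun y => f y • Y y, hf.smul_section Y.contMDiff⟩ x =
      f x • bracket X Y x + derivAlong f (anchor x (X x)) • Y x

/-- A family of alternating `k`-forms on the fibres of `E`, that is, a (not necessarily smooth)
section of the `k`-th exterior power of the dual bundle of `E`. -/
abbrev FibreForm {Q : Type*} (E : Q → Type*) [∀ x, AddCommGroup (E x)] [∀ x, Module ℝ (E x)]
    (k : ℕ) :=
  ∀ x, E x [⋀^Fin k]→ₗ[ℝ] ℝ

/-- The pull-back of a family of `k`-forms along a fibrewise linear map `F` over `f`. -/
def FibreForm.pullback {Q Q' : Type*} {E : Q → Type*} {E' : Q' → Type*}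
    [∀ x, AddCommGroup (E x)] [∀ x, Module ℝ (E x)]
    [∀ x, AddCommGroup (E' x)] [∀ x, Module ℝ (E' x)]
    {f : Q → Q'} (F : ∀ x, E x →ₗ[ℝ] E' (f x)) {k : ℕ} (φ : FibreForm E' k) : FibreForm E k :=
  fun x => (φ (f x)).compLinearMap (F x)

variable {m n : ℕ} {Q : Type*} [TopologicalSpace Q] [ChartedSpace (EuclideanSpace ℝ (Fin m)) Q]
  {E : Q → Type*} [∀ x, AddCommGroup (E x)] [∀ x, Module ℝ (E x)]
  [∀ x, TopologicalSpace (E x)] [TopologicalSpace (TotalSpace (EuclideanSpace ℝ (Fin n)) E)]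
  [FiberBundle (EuclideanSpace ℝ (Fin n)) E]

variable (m n) in
/-- Smoothness of a family of `k`-forms: its value on any `k` smooth sections is a smooth
function. -/
def FibreForm.IsSmooth {k : ℕ} (μ : FibreForm E k) : Prop :=
  ∀ X : Fin k → Sec m n E, ContMDiff (𝓡 m) 𝓘(ℝ, ℝ) ∞ (fun x => μ x (fun i => X i x))

/-- The tangent space at `x` of a subset `S` of a manifold: the span of the velocities at time `0`
of the smooth curves `(-ε, ε) → Q` lying in `S` and passing through `x` at time `0`. When `S` is
an embedded submanifold and `x ∈ S` these velocities already form the linear space `T_x S`. -/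
def tangentTo (m : ℕ) {Q : Type*} [TopologicalSpace Q] [ChartedSpace (EuclideanSpace ℝ (Fin m)) Q]
    (S : Set Q) (x : Q) : Submodule ℝ (TangentSpace (𝓡 m) x) :=
  Submodule.span ℝ {v | ∃ (c : ℝ → Q) (ε : ℝ), 0 < ε ∧
    ContMDiffOn 𝓘(ℝ, ℝ) (𝓡 m) ∞ c (Ioo (-ε) ε) ∧ (∀ t ∈ Ioo (-ε) ε, c t ∈ S) ∧
    (⟨c 0, mfderiv 𝓘(ℝ, ℝ) (𝓡 m) c 0 (1 : ℝ)⟩ : TangentBundle (𝓡 m) Q) = ⟨x, v⟩}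

variable [IsManifold (𝓡 m) ∞ Q] [VectorBundle ℝ (EuclideanSpace ℝ (Fin n)) E]

/-- The part of the Cartan formula for `d^E μ (X₀, …, X_k)` that involves brackets,
`∑_{i<j} (-1)^(i+j) μ([X_i, X_j], X₀, …, X̂_i, …, X̂_j, …, X_k)`; it is empty for functions. -/
def LieAlgebroid.bracketTerm (A : LieAlgebroid m n E) :
    (k : ℕ) → FibreForm E k → (Fin (k + 1) → Sec m n E) → Q → ℝ
  | 0, _, _, _ => 0
  | k + 1, μ, X, x =>
      ∑ j : Fin (k + 2), ∑ i : Fin (k + 1), if i.castSucc < j then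
        (-1 : ℝ) ^ (i.val + j.val) *
          μ x (Fin.cons (A.bracket (X i.castSucc) (X j) x)
            (fun l => i.removeNth (j.removeNth X) l x))
      else 0

/-- The right-hand side of the formula defining `d^E μ (X₀, …, X_k)` at the point `x`. -/
def LieAlgebroid.differential (A : LieAlgebroid m n E) {k : ℕ} (μ : FibreForm E k)
    (X : Fin (k + 1) → Sec m n E) (x : Q) : ℝ :=
  (∑ i : Fin (k + 1), (-1 : ℝ) ^ i.val *
    derivAlong (fun y => μ y (fun l => i.removeNth X l y)) (A.anchor x (X i x)))
  + A.bracketTerm k μ X x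

/-- `η = d^E μ`. (As `d^E μ` is tensorial, for each smooth `μ` there is exactly one such `η`.) -/
def LieAlgebroid.IsDifferential (A : LieAlgebroid m n E) {k : ℕ} (μ : FibreForm E k)
    (η : FibreForm E (k + 1)) : Prop :=
  ∀ (X : Fin (k + 1) → Sec m n E) (x : Q), η x (fun i => X i x) = A.differential μ X x

/-- A 2-section `Ω` and a 1-section `α`, both smooth and `d^E`-closed. -/
structure IsPresymplecticSystem (A : LieAlgebroid m n E) (Ω : FibreForm E 2)
    (α : FibreForm E 1) : Prop where
  smooth_two : Ω.IsSmooth m n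
  closed_two : A.IsDifferential Ω 0
  smooth_one : α.IsSmooth m n
  closed_one : A.IsDifferential α 0

/-- The preimage `ρ⁻¹(T_x S)` in the fibre `E_x`. -/
def LieAlgebroid.anchorPreimage (A : LieAlgebroid m n E) (S : Set Q) (x : Q) :
    Submodule ℝ (E x) :=
  (tangentTo m S x).comap (A.anchor x)

/-- The constraint subsets: `Q₀ = Q` and `Q_{k+1}` is the set of the `x ∈ Q_k` such that `α(x)`
vanishes on the `Ω(x)`-orthogonal of `ρ⁻¹(T_x Q_k)`. -/
def LieAlgebroid.constraintSet (A : LieAlgebroid m n E) (Ω : FibreForm E 2) (α : FibreForm E 1) :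
    ℕ → Set Q
  | 0 => univ
  | k + 1 => {x | x ∈ A.constraintSet Ω α k ∧ ∀ e : E x,
      (∀ f ∈ A.anchorPreimage (A.constraintSet Ω α k) x, Ω x ![e, f] = 0) → α x ![e] = 0}

/-- The fibre `(E_k)_x = ρ⁻¹(T_x Q_k)` (meaningful for `x ∈ Q_k`). -/
def LieAlgebroid.constraintFibre (A : LieAlgebroid m n E) (Ω : FibreForm E 2) (α : FibreForm E 1)
    (k : ℕ) (x : Q) : Submodule ℝ (E x) :=
  A.anchorPreimage (A.constraintSet Ω α k) x

/-- `E_k = ρ⁻¹(T Q_k)` as a subset of the total space of `E`. -/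
def LieAlgebroid.constraintTotal (A : LieAlgebroid m n E) (Ω : FibreForm E 2) (α : FibreForm E 1)
    (k : ℕ) : Set (TotalSpace (EuclideanSpace ℝ (Fin n)) E) :=
  {p | p.1 ∈ A.constraintSet Ω α k ∧ p.2 ∈ A.constraintFibre Ω α k p.1}

end Algebroid

section Morphisms

variable {m n m' n' : ℕ}
  {Q : Type*} [TopologicalSpace Q] [ChartedSpace (EuclideanSpace ℝ (Fin m)) Q]
  [IsManifold (𝓡 m) ∞ Q]
  {E : Q → Type*} [∀ x, AddCommGroup (E x)] [∀ x, Module ℝ (E x)]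
  [∀ x, TopologicalSpace (E x)] [TopologicalSpace (TotalSpace (EuclideanSpace ℝ (Fin n)) E)]
  [FiberBundle (EuclideanSpace ℝ (Fin n)) E] [VectorBundle ℝ (EuclideanSpace ℝ (Fin n)) E]
  {Q' : Type*} [TopologicalSpace Q'] [ChartedSpace (EuclideanSpace ℝ (Fin m')) Q']
  [IsManifold (𝓡 m') ∞ Q']
  {E' : Q' → Type*} [∀ x, AddCommGroup (E' x)] [∀ x, Module ℝ (E' x)]
  [∀ x, TopologicalSpace (E' x)] [TopologicalSpace (TotalSpace (EuclideanSpace ℝ (Fin n')) E')]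
  [FiberBundle (EuclideanSpace ℝ (Fin n')) E'] [VectorBundle ℝ (EuclideanSpace ℝ (Fin n')) E']

/-- `(F, f)` is a Lie algebroid morphism: a smooth vector bundle morphism whose pull-back of
sections of the exterior powers of the dual commutes with the differentials. -/
structure IsLieAlgebroidMorphism (A : LieAlgebroid m n E) (A' : LieAlgebroid m' n' E')
    (f : Q → Q') (F : ∀ x, E x →ₗ[ℝ] E' (f x)) : Prop where
  contMDiff_base : ContMDiff (𝓡 m) (𝓡 m') ∞ f
  contMDiff_total :
    ContMDiff ((𝓡 m).prod 𝓘(ℝ, EuclideanSpace ℝ (Fin n)))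
      ((𝓡 m').prod 𝓘(ℝ, EuclideanSpace ℝ (Fin n'))) ∞
      (fun p : TotalSpace (EuclideanSpace ℝ (Fin n)) E =>
        (⟨f p.1, F p.1 p.2⟩ : TotalSpace (EuclideanSpace ℝ (Fin n')) E'))
  differential : ∀ (k : ℕ) (φ : FibreForm E' k) (ψ : FibreForm E' (k + 1)),
    φ.IsSmooth m' n' → ψ.IsSmooth m' n' → A'.IsDifferential φ ψ →
    A.IsDifferential (φ.pullback F) (ψ.pullback F)

/-- `(Π, π)` is a dynamical Lie algebroid epimorphism from `(E, Ω, α)` to `(E', Ω', α')`. -/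
structure IsDynamicalEpimorphism (A : LieAlgebroid m n E) (Ω : FibreForm E 2) (α : FibreForm E 1)
    (A' : LieAlgebroid m' n' E') (Ω' : FibreForm E' 2) (α' : FibreForm E' 1)
    (π : Q → Q') (P : ∀ x, E x →ₗ[ℝ] E' (π x)) : Prop where
  morphism : IsLieAlgebroidMorphism A A' π P
  surjective : Function.Surjective π
  submersion : ∀ x, Function.Surjective (mfderiv (𝓡 m) (𝓡 m') π x)
  fibre_surjective : ∀ x, Function.Surjective (P x)
  pullback_two : Ω'.pullback P = Ω
  pullback_one : α'.pullback P = α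

/-- The structure of a Lie subalgebroid of `E` on the family of fibres `K x`, `x ∈ S`: `S` is an
embedded submanifold of `Q`, the `K x` form a smooth vector bundle over `S` and carry a Lie
algebroid structure such that the inclusion into `E` is a Lie algebroid morphism. (All of these
structures, if they exist, are determined by `S` and `K` up to the choice of atlases.) -/
structure LieSubalgebroid (A : LieAlgebroid m n E) (S : Set Q) (K : ∀ x, Submodule ℝ (E x)) where
  /-- the dimension of `S` -/
  dim : ℕ
  /-- the rank of the subbundle -/
  rank : ℕ
  charted : ChartedSpace (EuclideanSpace ℝ (Fin dim)) S
  isManifold : IsManifold (𝓡 dim) ∞ S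
  isSmoothEmbedding : Manifold.IsSmoothEmbedding (𝓡 dim) (𝓡 m) ∞ (Subtype.val : S → Q)
  topTotal : TopologicalSpace (TotalSpace (EuclideanSpace ℝ (Fin rank)) (fun x : S => K x))
  fiberBundle : FiberBundle (EuclideanSpace ℝ (Fin rank)) (fun x : S => K x)
  vectorBundle : VectorBundle ℝ (EuclideanSpace ℝ (Fin rank)) (fun x : S => K x)
  contMDiffVectorBundle :
    ContMDiffVectorBundle ∞ (EuclideanSpace ℝ (Fin rank)) (fun x : S => K x) (𝓡 dim)
  /-- the Lie algebroid structure on the subbundle -/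
  algebroid : LieAlgebroid dim rank (fun x : S => K x)
  inclusion : IsLieAlgebroidMorphism algebroid A (Subtype.val : S → Q) (fun x => (K x).subtype)

attribute [instance] LieSubalgebroid.charted LieSubalgebroid.isManifold LieSubalgebroid.topTotal
  LieSubalgebroid.fiberBundle LieSubalgebroid.vectorBundle LieSubalgebroid.contMDiffVectorBundle

/-- The restriction of a family of forms on `E` to the fibres `K x`, `x ∈ S`. -/
def FibreForm.restrict {Q : Type*} {E : Q → Type*} [∀ x, AddCommGroup (E x)]
    [∀ x, Module ℝ (E x)] {k : ℕ} (φ : FibreForm E k) (S : Set Q) (K : ∀ x, Submodule ℝ (E x)) :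
    FibreForm (fun x : S => K x) k :=
  FibreForm.pullback (f := (Subtype.val : S → Q)) (fun x => (K x).subtype) φ

/-- The smooth sections of a Lie subalgebroid. -/
abbrev LieSubalgebroid.Sections {A : LieAlgebroid m n E} {S : Set Q}
    {K : ∀ x, Submodule ℝ (E x)} (R : LieSubalgebroid A S K) :=
  Sec R.dim R.rank (fun x : S => K x)

/-- The section `X` of the subbundle `K` over `S` solves `i_X Ω = α` along `S`; the equation holds
in the dual of the full fibre `E_x`, for every `x ∈ S`. -/
def SolvesAlong {Q : Type*} {E : Q → Type*} [∀ x, AddCommGroup (E x)] [∀ x, Module ℝ (E x)]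
    (Ω : FibreForm E 2) (α : FibreForm E 1) {S : Set Q} {K : ∀ x, Submodule ℝ (E x)}
    (X : ∀ x : S, K x) : Prop :=
  ∀ (x : S) (e : E x), Ω x ![(X x : E x), e] = α x ![e]

end Morphisms

end

/-! Everything rests on one identity: each stage upstairs is the full preimage of the stage
downstairs, `Q_k = π⁻¹(Q'_k)`, and over `Q_k` the fibre of `E_k` is `Π⁻¹(E'_k)`. Granting it for
`k`, the tangent spaces satisfy `T Q_k = (dπ)⁻¹(T Q'_k)` because `π` is a submersion
(`tangentTo_preimage`). A Lie algebroid morphism satisfies `dπ ∘ ρ = ρ' ∘ Π`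
(`IsLieAlgebroidMorphism.mfderiv_anchor`), so `ρ⁻¹(T Q_k) = Π⁻¹(ρ'⁻¹(T Q'_k))`. Since `Ω` and `α`
are pull-backs and `Π` is onto on fibres, the condition cutting out `Q_{k+1}` at `x` is the one
cutting out `Q'_{k+1}` at `π x`. Images, saturation, simultaneous stabilization and the
correspondence of solutions follow from surjectivity.

The remaining work is to show that the restriction `Π_k` is again a Lie algebroid morphism, for all
forms on `E'_k` and in all degrees. The morphism properties of `Π` and of the two inclusions
directly handle only forms on `E'_k` that are restrictions of forms on `E'`. Already the 1-forms
among them separate the points of each fibre, and this is enough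
(`isLieAlgebroidMorphism_of_separating`): testing Cartan's formula in degree one against separating
1-forms determines the image of a bracket (`SectionFrame.map_bracket`), and this together with
anchor compatibility gives Cartan's formula in every degree.

Lifts of solutions come from a fibrewise surjective bundle map having local smooth right inverses,
glued by a partition of unity (`exists_lift`); any lift of a solution is a solution. -/

section

open Filter Topology

/-! ### Global sections forming local frames, and smoothness tested in them -/

section Frames

variable {m n : ℕ} {Q : Type*} [TopologicalSpace Q] [ChartedSpace (EuclideanSpace ℝ (Fin m)) Q]
  {E : Q → Type*} [∀ x, AddCommGroup (E x)] [∀ x, Module ℝ (E x)]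
  [∀ x, TopologicalSpace (E x)] [TopologicalSpace (TotalSpace (EuclideanSpace ℝ (Fin n)) E)]
  [FiberBundle (EuclideanSpace ℝ (Fin n)) E]

variable (m n E) in
/-- Global smooth sections and global smooth dual sections of a vector bundle which form a frame
and its dual frame on some neighbourhood of the point `x₀`. -/
structure SectionFrame (x₀ : Q) where
  /-- the sections -/
  sec : Fin n → Sec m n E
  /-- the dual sections -/
  coord : Fin n → ∀ x, E x →ₗ[ℝ] ℝ
  contMDiff_coord : ∀ a, ContMDiff ((𝓡 m).prod 𝓘(ℝ, EuclideanSpace ℝ (Fin n))) 𝓘(ℝ, ℝ) ∞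
    (fun p : TotalSpace (EuclideanSpace ℝ (Fin n)) E => coord a p.1 p.2)
  eventually_sum : ∀ᶠ x in 𝓝 x₀, ∀ e : E x, e = ∑ a, coord a x e • sec a x
  eventually_coord : ∀ᶠ x in 𝓝 x₀, ∀ a b, coord a x (sec b x) = if a = b then 1 else 0

/-- The local frame of a trivialization and its coordinate forms are both multiplied by the same
bump function and so extend by zero; they are dual frames wherever the bump equals 1. Having global
objects matters because brackets and differentials are only defined on global sections. -/
theorem SectionFrame.nonempty [T2Space Q] [IsManifold (𝓡 m) ∞ Q]
    [VectorBundle ℝ (EuclideanSpace ℝ (Fin n)) E]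
    [ContMDiffVectorBundle ∞ (EuclideanSpace ℝ (Fin n)) E (𝓡 m)] (x₀ : Q) :
    Nonempty (SectionFrame m n E x₀) := by
  set e := trivializationAt (EuclideanSpace ℝ (Fin n)) E x₀ with he
  have hx₀ : e.baseSet ∈ 𝓝 x₀ :=
    e.open_baseSet.mem_nhds (FiberBundle.mem_baseSet_trivializationAt _ _ _)
  obtain ⟨χ, -, hχ⟩ := (SmoothBumpFunction.nhds_basis_tsupport (I := 𝓡 m) x₀).mem_iff.1 hx₀
  set b := (EuclideanSpace.basisFun (Fin n) ℝ).toBasis with hb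
  have hs : ∀ a, ContMDiff (𝓡 m) ((𝓡 m).prod 𝓘(ℝ, EuclideanSpace ℝ (Fin n))) ∞
      (fun x => TotalSpace.mk' (EuclideanSpace ℝ (Fin n)) x (((χ : Q → ℝ) • e.localFrame b a) x)) :=
    fun a => (χ.contMDiff.contMDiffOn).smul_section_of_tsupport e.open_baseSet hχ
      (e.contMDiffOn_localFrame_baseSet ∞ b a)
  have hone : ∀ᶠ x in 𝓝 x₀, χ x = 1 := χ.eventuallyEq_one
  refine ⟨⟨fun a => ⟨_, hs a⟩,
    fun a x => χ x • ((EuclideanSpace.proj a).toLinearMap ∘ₗ e.linearMapAt ℝ x), ?_, ?_, ?_⟩⟩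
  · intro a p
    by_cases hp : p.1 ∈ e.baseSet
    · have h1 : ContMDiffAt ((𝓡 m).prod 𝓘(ℝ, EuclideanSpace ℝ (Fin n))) 𝓘(ℝ, ℝ) ∞
          (fun p : TotalSpace (EuclideanSpace ℝ (Fin n)) E => χ p.1) p :=
        (χ.contMDiff (x := p.1)).comp p (Bundle.contMDiffAt_proj E)
      have h2 : ContMDiffAt ((𝓡 m).prod 𝓘(ℝ, EuclideanSpace ℝ (Fin n)))
          𝓘(ℝ, EuclideanSpace ℝ (Fin n)) ∞
          (fun p : TotalSpace (EuclideanSpace ℝ (Fin n)) E => (e p).2) p :=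
        ((e.contMDiffOn (IB := 𝓡 m) (n := ∞)).contMDiffAt
          (e.open_source.mem_nhds (e.mem_source.2 hp))).snd
      have h3 : ContMDiffAt ((𝓡 m).prod 𝓘(ℝ, EuclideanSpace ℝ (Fin n))) 𝓘(ℝ, ℝ) ∞
          (fun p : TotalSpace (EuclideanSpace ℝ (Fin n)) E =>
            EuclideanSpace.proj (𝕜 := ℝ) a (e p).2) p :=
        (EuclideanSpace.proj (𝕜 := ℝ) a).contMDiff.contMDiffAt.comp p h2
      refine (h1.mul h3).congr_of_eventuallyEq ?_
      filter_upwards [(e.open_baseSet.preimage (FiberBundle.continuous_proj _ E)).mem_nhds hp]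
        with q hq
      simp [show q.1 ∈ e.baseSet from hq]
    -- Outside the base set the form vanishes on a neighbourhood, since the closed support of the
    -- bump lies inside the base set.
    · have hp' : p.1 ∈ (tsupport χ)ᶜ := fun h => hp (hχ h)
      refine (contMDiffAt_const (c := (0 : ℝ))).congr_of_eventuallyEq ?_
      filter_upwards [((isClosed_tsupport χ).isOpen_compl.preimage
        (FiberBundle.continuous_proj _ E)).mem_nhds hp'] with q hq
      simp [image_eq_zero_of_notMem_tsupport hq]
  · filter_upwards [hx₀, hone] with x hx h1 v
    conv_lhs => rw [← (e.basisAt b hx).sum_repr v]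
    refine Finset.sum_congr rfl fun a _ => ?_
    simp [h1, hx, Bundle.Trivialization.basisAt, hb]
  · filter_upwards [hx₀, hone] with x hx h1 a c
    simp [h1, hx, Bundle.Trivialization.basisAt, hb]

theorem SectionFrame.sum_coord {x₀ : Q} (Z : SectionFrame m n E x₀) (e : E x₀) :
    e = ∑ a, Z.coord a x₀ e • Z.sec a x₀ :=
  Z.eventually_sum.self_of_nhds e

theorem SectionFrame.coord_sec {x₀ : Q} (Z : SectionFrame m n E x₀) (a b : Fin n) :
    Z.coord a x₀ (Z.sec b x₀) = if a = b then 1 else 0 :=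
  Z.eventually_coord.self_of_nhds a b

theorem SectionFrame.coord_sum {x₀ : Q} (Z : SectionFrame m n E x₀) (w : Fin n → ℝ) (b : Fin n) :
    Z.coord b x₀ (∑ a, w a • Z.sec a x₀) = w b := by
  simp [map_sum, Z.coord_sec]

theorem SectionFrame.ext_coord {x₀ : Q} (Z : SectionFrame m n E x₀) {e e' : E x₀}
    (h : ∀ a, Z.coord a x₀ e = Z.coord a x₀ e') : e = e' := by
  rw [Z.sum_coord e, Z.sum_coord e']
  exact Finset.sum_congr rfl fun a _ => by rw [h a]

/-- Every vector of a smooth vector bundle is the value of a global smooth section. -/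
theorem exists_sec_apply_eq [T2Space Q] [IsManifold (𝓡 m) ∞ Q]
    [VectorBundle ℝ (EuclideanSpace ℝ (Fin n)) E]
    [ContMDiffVectorBundle ∞ (EuclideanSpace ℝ (Fin n)) E (𝓡 m)] {x : Q} (e : E x) :
    ∃ X : Sec m n E, X x = e := by
  obtain ⟨Z⟩ := SectionFrame.nonempty (m := m) (n := n) (E := E) x
  refine ⟨∑ a, Z.coord a x e • Z.sec a, ?_⟩
  conv_rhs => rw [Z.sum_coord e]
  have : ∀ s : Finset (Fin n), (∑ a ∈ s, Z.coord a x e • Z.sec a : Sec m n E) x =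
      ∑ a ∈ s, Z.coord a x e • Z.sec a x := by
    classical
    intro s
    induction s using Finset.induction_on with
    | empty => simp
    | insert a s ha ih => rw [Finset.sum_insert ha, Finset.sum_insert ha, ← ih]; rfl
  exact this _

theorem AlternatingMap.map_fun_sum_smul {V : Type*} [AddCommGroup V] [Module ℝ V] {k n : ℕ}
    (φ : V [⋀^Fin k]→ₗ[ℝ] ℝ) (c : Fin k → Fin n → ℝ) (z : Fin n → V) :
    φ (fun l => ∑ a, c l a • z a) =
      ∑ a : Fin k → Fin n, (∏ l, c l (a l)) * φ (fun l => z (a l)) := by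
  change φ.toMultilinearMap _ = _
  rw [MultilinearMap.map_sum]
  refine Finset.sum_congr rfl fun a _ => ?_
  rw [MultilinearMap.map_smul_univ]
  rfl

/-- An alternating `1`-form as a linear form. -/
def AlternatingMap.linearOne {V : Type*} [AddCommGroup V] [Module ℝ V] (φ : V [⋀^Fin 1]→ₗ[ℝ] ℝ) :
    V →ₗ[ℝ] ℝ :=
  (AlternatingMap.ofSubsingleton ℝ V ℝ (0 : Fin 1)).symm φ

theorem AlternatingMap.linearOne_apply {V : Type*} [AddCommGroup V] [Module ℝ V]
    (φ : V [⋀^Fin 1]→ₗ[ℝ] ℝ) (e : V) : φ.linearOne e = φ ![e] :=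
  congrArg φ (funext fun i => by fin_cases i; rfl)

theorem FibreForm.IsSmooth.contMDiff_one {μ : FibreForm E 1} (hμ : μ.IsSmooth m n)
    (V : Sec m n E) : ContMDiff (𝓡 m) 𝓘(ℝ, ℝ) ∞ (fun y => μ y ![V y]) := by
  have := hμ ![V]
  convert this using 3 with y
  ext i; fin_cases i; rfl

section Smoothness

variable {V : Type*} [NormedAddCommGroup V] [NormedSpace ℝ V] {H : Type*} [TopologicalSpace H]
  {I : ModelWithCorners ℝ V H} {M : Type*} [TopologicalSpace M] [ChartedSpace H M]

theorem SectionFrame.contMDiffAt_coord {x₀ : Q} (Z : SectionFrame m n E x₀) (a : Fin n)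
    {g : M → Q} {W : ∀ p, E (g p)} {p₀ : M}
    (hW : ContMDiffAt I ((𝓡 m).prod 𝓘(ℝ, EuclideanSpace ℝ (Fin n))) ∞
      (fun p => (⟨g p, W p⟩ : TotalSpace (EuclideanSpace ℝ (Fin n)) E)) p₀) :
    ContMDiffAt I 𝓘(ℝ, ℝ) ∞ (fun p => Z.coord a (g p) (W p)) p₀ :=
  (Z.contMDiff_coord a).contMDiffAt.comp p₀ hW

/-- A smooth family of forms takes smooth values on vectors depending smoothly on a parameter. -/
theorem FibreForm.IsSmooth.contMDiffAt_apply [T2Space Q] [IsManifold (𝓡 m) ∞ Q]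
    [VectorBundle ℝ (EuclideanSpace ℝ (Fin n)) E]
    [ContMDiffVectorBundle ∞ (EuclideanSpace ℝ (Fin n)) E (𝓡 m)] {k : ℕ} {φ : FibreForm E k}
    (hφ : φ.IsSmooth m n) {g : M → Q} {W : Fin k → ∀ p, E (g p)} {p₀ : M}
    (hg : ContMDiffAt I (𝓡 m) ∞ g p₀)
    (hW : ∀ l, ContMDiffAt I ((𝓡 m).prod 𝓘(ℝ, EuclideanSpace ℝ (Fin n))) ∞
      (fun p => (⟨g p, W l p⟩ : TotalSpace (EuclideanSpace ℝ (Fin n)) E)) p₀) :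
    ContMDiffAt I 𝓘(ℝ, ℝ) ∞ (fun p => φ (g p) (fun l => W l p)) p₀ := by
  obtain ⟨Z⟩ := SectionFrame.nonempty (m := m) (n := n) (E := E) (g p₀)
  -- Multilinear expansion in the frame leaves only values of `φ` on global sections, which are
  -- smooth by hypothesis.
  have h : ContMDiffAt I 𝓘(ℝ, ℝ) ∞ (fun p => ∑ a : Fin k → Fin n,
      (∏ l, Z.coord (a l) (g p) (W l p)) * φ (g p) (fun l => Z.sec (a l) (g p))) p₀ :=
    contMDiffAt_finsetSum fun a _ => (contMDiffAt_finsetProd fun l _ =>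
      Z.contMDiffAt_coord (a l) (hW l)).mul
        ((hφ fun l => Z.sec (a l)).contMDiffAt.comp p₀ hg)
  refine h.congr_of_eventuallyEq ?_
  filter_upwards [hg.continuousAt.eventually Z.eventually_sum] with p hp
  rw [← AlternatingMap.map_fun_sum_smul (φ (g p)) (fun l a => Z.coord a (g p) (W l p))
    (fun a => Z.sec a (g p))]
  exact congrArg _ (funext fun l => hp _)

/-- A map into the total space is smooth if its coordinates in a local frame are. -/
theorem SectionFrame.contMDiffAt_total [IsManifold (𝓡 m) ∞ Q]
    [VectorBundle ℝ (EuclideanSpace ℝ (Fin n)) E]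
    [ContMDiffVectorBundle ∞ (EuclideanSpace ℝ (Fin n)) E (𝓡 m)]
    {g : M → Q} {p₀ : M} (Z : SectionFrame m n E (g p₀)) {w : Fin n → M → ℝ} {W : ∀ p, E (g p)}
    (hg : ContMDiffAt I (𝓡 m) ∞ g p₀) (hw : ∀ a, ContMDiffAt I 𝓘(ℝ, ℝ) ∞ (w a) p₀)
    (hW : ∀ᶠ p in 𝓝 p₀, W p = ∑ a, w a p • Z.sec a (g p)) :
    ContMDiffAt I ((𝓡 m).prod 𝓘(ℝ, EuclideanSpace ℝ (Fin n))) ∞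
      (fun p => (⟨g p, W p⟩ : TotalSpace (EuclideanSpace ℝ (Fin n)) E)) p₀ := by
  rw [Bundle.contMDiffAt_totalSpace]
  refine ⟨hg, ?_⟩
  set e := trivializationAt (EuclideanSpace ℝ (Fin n)) E (g p₀)
  have hx₀ : e.baseSet ∈ 𝓝 (g p₀) :=
    e.open_baseSet.mem_nhds (FiberBundle.mem_baseSet_trivializationAt _ _ _)
  have h : ContMDiffAt I 𝓘(ℝ, EuclideanSpace ℝ (Fin n)) ∞
      (fun p => ∑ a, w a p • (e ⟨g p, Z.sec a (g p)⟩).2) p₀ := by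
    refine contMDiffAt_finsetSum fun a _ => (hw a).smul ?_
    exact (Bundle.contMDiffAt_totalSpace.1
      ((Z.sec a).contMDiff.contMDiffAt.comp p₀ hg)).2
  refine h.congr_of_eventuallyEq ?_
  filter_upwards [hW, hg.continuousAt.eventually hx₀] with p hp hp'
  have hl : ∀ v : E (g p), (e ⟨g p, v⟩).2 = e.linearMapAt ℝ (g p) v := fun v => by
    rw [Bundle.Trivialization.linearMapAt_apply, if_pos (show g p ∈ e.baseSet from hp')]
  change (e ⟨g p, W p⟩).2 = _
  rw [hl, hp]
  simp [hl]

end Smoothness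

end Frames

/-! ### Smooth dependence of the inverse matrix -/

section MatrixInverse

variable {V : Type*} [NormedAddCommGroup V] [NormedSpace ℝ V] {H : Type*} [TopologicalSpace H]
  {I : ModelWithCorners ℝ V H} {M : Type*} [TopologicalSpace M] [ChartedSpace H M]

theorem contMDiffAt_matrix_det {n : ℕ} {G : M → Matrix (Fin n) (Fin n) ℝ} {p₀ : M}
    (hG : ∀ a b, ContMDiffAt I 𝓘(ℝ, ℝ) ∞ (fun p => G p a b) p₀) :
    ContMDiffAt I 𝓘(ℝ, ℝ) ∞ (fun p => (G p).det) p₀ := by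
  simp_rw [Matrix.det_apply']
  exact contMDiffAt_finsetSum fun σ _ => contMDiffAt_const.mul
    (contMDiffAt_finsetProd fun i _ => hG _ _)

/-- Cramer's rule: an entry of the inverse is the inverse of the determinant times the determinant
of the matrix with one row replaced by a basis vector. -/
theorem contMDiffAt_matrix_inv {n : ℕ} {G : M → Matrix (Fin n) (Fin n) ℝ} {p₀ : M}
    (hG : ∀ a b, ContMDiffAt I 𝓘(ℝ, ℝ) ∞ (fun p => G p a b) p₀) (h₀ : (G p₀).det ≠ 0)
    (a b : Fin n) : ContMDiffAt I 𝓘(ℝ, ℝ) ∞ (fun p => (G p)⁻¹ a b) p₀ := by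
  have hd := contMDiffAt_matrix_det hG
  have : ∀ p, (G p)⁻¹ a b = ((G p).det)⁻¹ * ((G p).updateRow b (Pi.single a 1)).det := fun p => by
    rw [Matrix.inv_def, Matrix.smul_apply, Matrix.adjugate_apply, Ring.inverse_eq_inv', smul_eq_mul]
  simp_rw [this]
  refine ((contDiffAt_inv ℝ h₀).contMDiffAt.comp p₀ hd).mul (contMDiffAt_matrix_det fun i j => ?_)
  by_cases hi : i = b
  · subst hi
    simpa using contMDiffAt_const
  · simpa [Matrix.updateRow_ne hi] using hG i j

end MatrixInverse

/-! ### Fibrewise injective and fibrewise surjective bundle maps -/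

section BundleMaps

variable {m n m' n' : ℕ} {V : Type*} [NormedAddCommGroup V] [NormedSpace ℝ V]
  {H : Type*} [TopologicalSpace H] {I : ModelWithCorners ℝ V H}
  {M : Type*} [TopologicalSpace M] [ChartedSpace H M]
  {Q : Type*} [TopologicalSpace Q] [ChartedSpace (EuclideanSpace ℝ (Fin m)) Q]
  {E : Q → Type*} [∀ x, AddCommGroup (E x)] [∀ x, Module ℝ (E x)]
  [∀ x, TopologicalSpace (E x)] [TopologicalSpace (TotalSpace (EuclideanSpace ℝ (Fin n)) E)]
  [FiberBundle (EuclideanSpace ℝ (Fin n)) E]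
  {Q' : Type*} [TopologicalSpace Q'] [ChartedSpace (EuclideanSpace ℝ (Fin m')) Q']
  {E' : Q' → Type*} [∀ x, AddCommGroup (E' x)] [∀ x, Module ℝ (E' x)]
  [∀ x, TopologicalSpace (E' x)] [TopologicalSpace (TotalSpace (EuclideanSpace ℝ (Fin n')) E')]
  [FiberBundle (EuclideanSpace ℝ (Fin n')) E']
  {f : Q → Q'} {F : ∀ x, E x →ₗ[ℝ] E' (f x)}

/-- The matrix of a bundle map with respect to two section frames. -/
noncomputable def SectionFrame.mapMatrix {x₀ : Q} {y₀ : Q'} (Z : SectionFrame m n E x₀)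
    (Y : SectionFrame m' n' E' y₀) (F : ∀ x, E x →ₗ[ℝ] E' (f x)) (x : Q) :
    Matrix (Fin n') (Fin n) ℝ :=
  Matrix.of fun b a => Y.coord b (f x) (F x (Z.sec a x))

theorem SectionFrame.contMDiff_mapMatrix {x₀ : Q} {y₀ : Q'} (Z : SectionFrame m n E x₀)
    (Y : SectionFrame m' n' E' y₀)
    (hF : ContMDiff ((𝓡 m).prod 𝓘(ℝ, EuclideanSpace ℝ (Fin n)))
      ((𝓡 m').prod 𝓘(ℝ, EuclideanSpace ℝ (Fin n'))) ∞
      (fun p : TotalSpace (EuclideanSpace ℝ (Fin n)) E =>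
        (⟨f p.1, F p.1 p.2⟩ : TotalSpace (EuclideanSpace ℝ (Fin n')) E'))) (b : Fin n') (a : Fin n) :
    ContMDiff (𝓡 m) 𝓘(ℝ, ℝ) ∞ (fun x => Z.mapMatrix Y F x b a) :=
  (Y.contMDiff_coord b).comp (hF.comp (Z.sec a).contMDiff)

theorem SectionFrame.mapMatrix_mulVec {x₀ : Q} {y₀ : Q'} (Z : SectionFrame m n E x₀)
    (Y : SectionFrame m' n' E' y₀) (F : ∀ x, E x →ₗ[ℝ] E' (f x)) (x : Q) (w : Fin n → ℝ)
    (b : Fin n') :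
    (Z.mapMatrix Y F x).mulVec w b = Y.coord b (f x) (F x (∑ a, w a • Z.sec a x)) := by
  simp [Matrix.mulVec, dotProduct, SectionFrame.mapMatrix, map_sum, mul_comm]

variable [IsManifold (𝓡 m) ∞ Q] [T2Space Q] [VectorBundle ℝ (EuclideanSpace ℝ (Fin n)) E]
  [ContMDiffVectorBundle ∞ (EuclideanSpace ℝ (Fin n)) E (𝓡 m)]
  [IsManifold (𝓡 m') ∞ Q'] [T2Space Q'] [VectorBundle ℝ (EuclideanSpace ℝ (Fin n')) E']
  [ContMDiffVectorBundle ∞ (EuclideanSpace ℝ (Fin n')) E' (𝓡 m')]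

/-- A map into a vector bundle is smooth if its composition with a smooth bundle map which is
injective on fibres is smooth. -/
theorem contMDiffAt_total_of_comp_injective
    (hF : ContMDiff ((𝓡 m).prod 𝓘(ℝ, EuclideanSpace ℝ (Fin n)))
      ((𝓡 m').prod 𝓘(ℝ, EuclideanSpace ℝ (Fin n'))) ∞
      (fun p : TotalSpace (EuclideanSpace ℝ (Fin n)) E =>
        (⟨f p.1, F p.1 p.2⟩ : TotalSpace (EuclideanSpace ℝ (Fin n')) E')))
    {g : M → Q} {W : ∀ p, E (g p)} {p₀ : M} (hg : ContMDiffAt I (𝓡 m) ∞ g p₀)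
    (hinj : Function.Injective (F (g p₀)))
    (hFW : ContMDiffAt I ((𝓡 m').prod 𝓘(ℝ, EuclideanSpace ℝ (Fin n'))) ∞
      (fun p => (⟨f (g p), F (g p) (W p)⟩ : TotalSpace (EuclideanSpace ℝ (Fin n')) E')) p₀) :
    ContMDiffAt I ((𝓡 m).prod 𝓘(ℝ, EuclideanSpace ℝ (Fin n))) ∞
      (fun p => (⟨g p, W p⟩ : TotalSpace (EuclideanSpace ℝ (Fin n)) E)) p₀ := by
  obtain ⟨Z⟩ := SectionFrame.nonempty (m := m) (n := n) (E := E) (g p₀)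
  obtain ⟨Y⟩ := SectionFrame.nonempty (m := m') (n := n') (E := E') (f (g p₀))
  set B : M → Matrix (Fin n') (Fin n) ℝ := fun p => Z.mapMatrix Y F (g p) with hB
  have hBs : ∀ b a, ContMDiffAt I 𝓘(ℝ, ℝ) ∞ (fun p => B p b a) p₀ := fun b a =>
    (Z.contMDiff_mapMatrix Y hF b a).contMDiffAt.comp p₀ hg
  have hBinj : Function.Injective (B p₀).mulVec := by
    intro w w' h
    have h1 : ∑ a, w a • Z.sec a (g p₀) = ∑ a, w' a • Z.sec a (g p₀) := by
      refine hinj (Y.ext_coord fun b => ?_)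
      rw [← Z.mapMatrix_mulVec, ← Z.mapMatrix_mulVec]
      exact congrFun h b
    funext a
    rw [← Z.coord_sum w, ← Z.coord_sum w', h1]
  -- A constant left inverse at `p₀` suffices: `L * B p` stays invertible nearby, so `(L * B p)⁻¹ *
  -- L` is a smooth left inverse of `B p` that recovers the coordinates of `W` from those of its
  -- image.
  obtain ⟨L, hL⟩ : ∃ L : Matrix (Fin n) (Fin n') ℝ, L * B p₀ = 1 := by
    obtain ⟨l, hl⟩ := LinearMap.exists_leftInverse_of_injective (Matrix.toLin' (B p₀))
      (LinearMap.ker_eq_bot.2 hBinj)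
    refine ⟨LinearMap.toMatrix' l, ?_⟩
    rw [← LinearMap.toMatrix'_toLin' (B p₀), ← LinearMap.toMatrix'_comp, hl,
      LinearMap.toMatrix'_id]
  have hLB : ∀ a a', ContMDiffAt I 𝓘(ℝ, ℝ) ∞ (fun p => (L * B p) a a') p₀ := fun a a' => by
    simp_rw [Matrix.mul_apply]
    exact contMDiffAt_finsetSum fun b _ => contMDiffAt_const.mul (hBs b a')
  have hdet : ((L * B p₀)).det ≠ 0 := by rw [hL]; simp
  have hinv := contMDiffAt_matrix_inv hLB hdet
  have hcF : ∀ b, ContMDiffAt I 𝓘(ℝ, ℝ) ∞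
      (fun p => Y.coord b (f (g p)) (F (g p) (W p))) p₀ := fun b => Y.contMDiffAt_coord b hFW
  refine Z.contMDiffAt_total (w := fun a p => ((L * B p)⁻¹.mulVec
    (L.mulVec fun b => Y.coord b (f (g p)) (F (g p) (W p)))) a) hg (fun a => ?_) ?_
  · simp only [Matrix.mulVec, dotProduct]
    exact contMDiffAt_finsetSum fun a' _ => (hinv a a').mul
      (contMDiffAt_finsetSum fun b _ => contMDiffAt_const.mul (hcF b))
  · filter_upwards [hg.continuousAt.eventually Z.eventually_sum,
      (contMDiffAt_matrix_det hLB).continuousAt.eventually_ne hdet] with p hp hp'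
    have h1 : (fun b => Y.coord b (f (g p)) (F (g p) (W p))) =
        (B p).mulVec (fun a => Z.coord a (g p) (W p)) := by
      funext b
      rw [hB, Z.mapMatrix_mulVec, ← hp]
    have h2 : (L * B p)⁻¹.mulVec (L.mulVec fun b => Y.coord b (f (g p)) (F (g p) (W p))) =
        fun a => Z.coord a (g p) (W p) := by
      rw [h1, Matrix.mulVec_mulVec, Matrix.mulVec_mulVec, Matrix.mul_assoc,
        Matrix.nonsing_inv_mul _ (Ne.isUnit hp'), Matrix.one_mulVec]
    rw [h2]
    exact hp _

/-- Sections along a smooth bundle map which is surjective on fibres lift locally. -/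
theorem exists_local_lift
    (hF : ContMDiff ((𝓡 m).prod 𝓘(ℝ, EuclideanSpace ℝ (Fin n)))
      ((𝓡 m').prod 𝓘(ℝ, EuclideanSpace ℝ (Fin n'))) ∞
      (fun p : TotalSpace (EuclideanSpace ℝ (Fin n)) E =>
        (⟨f p.1, F p.1 p.2⟩ : TotalSpace (EuclideanSpace ℝ (Fin n')) E')))
    (hf : ContMDiff (𝓡 m) (𝓡 m') ∞ f)
    {x₀ : Q} (hsurj : Function.Surjective (F x₀)) (X' : Sec m' n' E') :
    ∃ U ∈ 𝓝 x₀, ∃ s : ∀ x, E x,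
      ContMDiffOn (𝓡 m) ((𝓡 m).prod 𝓘(ℝ, EuclideanSpace ℝ (Fin n))) ∞
        (fun x => TotalSpace.mk' (EuclideanSpace ℝ (Fin n)) x (s x)) U ∧
      ∀ x ∈ U, F x (s x) = X' (f x) := by
  obtain ⟨Z⟩ := SectionFrame.nonempty (m := m) (n := n) (E := E) x₀
  obtain ⟨Y⟩ := SectionFrame.nonempty (m := m') (n := n') (E := E') (f x₀)
  set C : Q → Matrix (Fin n') (Fin n) ℝ := fun x => Z.mapMatrix Y F x with hC
  have hCs : ∀ b a, ContMDiff (𝓡 m) 𝓘(ℝ, ℝ) ∞ (fun p => C p b a) := fun b a =>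
    Z.contMDiff_mapMatrix Y hF b a
  have hCsurj : Function.Surjective (C x₀).mulVec := by
    intro u
    obtain ⟨e, he⟩ := hsurj (∑ b, u b • Y.sec b (f x₀))
    refine ⟨fun a => Z.coord a x₀ e, funext fun b => ?_⟩
    rw [hC, Z.mapMatrix_mulVec, ← Z.sum_coord, he, Y.coord_sum]
  -- Dually to the injective case, `R * (C x * R)⁻¹` is a smooth right inverse of `C x` near `x₀`.
  obtain ⟨R, hR⟩ := Matrix.mulVec_surjective_iff_exists_right_inverse.1 hCsurj
  have hCR : ∀ a a', ContMDiff (𝓡 m) 𝓘(ℝ, ℝ) ∞ (fun x => (C x * R) a a') := fun a a' => by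
    simp_rw [Matrix.mul_apply]
    exact contMDiff_finsetSum fun b _ => (hCs a b).mul contMDiff_const
  have hdet : ((C x₀ * R)).det ≠ 0 := by rw [hR]; simp
  have hd : Continuous fun x => (C x * R).det := continuous_iff_continuousAt.2 fun x =>
    (contMDiffAt_matrix_det fun a b => (hCR a b).contMDiffAt).continuousAt
  have hc' : ∀ b, ContMDiff (𝓡 m) 𝓘(ℝ, ℝ) ∞ (fun x => Y.coord b (f x) (X' (f x))) := fun b =>
    (Y.contMDiff_coord b).comp (X'.contMDiff.comp hf)
  refine ⟨{x | (∀ e : E' (f x), e = ∑ b, Y.coord b (f x) e • Y.sec b (f x)) ∧ (C x * R).det ≠ 0},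
    ?_, fun x => ∑ a, (R.mulVec ((C x * R)⁻¹.mulVec fun b => Y.coord b (f x) (X' (f x)))) a •
      Z.sec a x, ?_, ?_⟩
  · exact (hf.continuous.continuousAt.eventually Y.eventually_sum).and
      (hd.continuousAt.eventually_ne hdet)
  · rintro x ⟨-, hx⟩
    refine ContMDiffAt.contMDiffWithinAt (ContMDiffAt.sum_section fun a _ => ?_)
    refine ContMDiffAt.smul_section ?_ (Z.sec a).contMDiff.contMDiffAt
    simp only [Matrix.mulVec, dotProduct]
    exact contMDiffAt_finsetSum fun a' _ => contMDiffAt_const.mul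
      (contMDiffAt_finsetSum fun b _ =>
        (contMDiffAt_matrix_inv (fun a b => (hCR a b).contMDiffAt) hx _ _).mul (hc' b).contMDiffAt)
  · rintro x ⟨hx, hx'⟩
    rw [hx (F x _), hx (X' (f x))]
    refine Finset.sum_congr rfl fun b _ => ?_
    rw [← Z.mapMatrix_mulVec Y F x, Matrix.mulVec_mulVec, Matrix.mulVec_mulVec]
    rw [Matrix.mul_nonsing_inv _ (Ne.isUnit hx'), Matrix.one_mulVec]

/-- A global smooth lift of a section along a smooth bundle map which is surjective on fibres. -/
theorem exists_lift [SecondCountableTopology Q]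
    (hF : ContMDiff ((𝓡 m).prod 𝓘(ℝ, EuclideanSpace ℝ (Fin n)))
      ((𝓡 m').prod 𝓘(ℝ, EuclideanSpace ℝ (Fin n'))) ∞
      (fun p : TotalSpace (EuclideanSpace ℝ (Fin n)) E =>
        (⟨f p.1, F p.1 p.2⟩ : TotalSpace (EuclideanSpace ℝ (Fin n')) E')))
    (hf : ContMDiff (𝓡 m) (𝓡 m') ∞ f)
    (hsurj : ∀ x, Function.Surjective (F x)) (X' : Sec m' n' E') :
    ∃ X : Sec m n E, ∀ x, F x (X x) = X' (f x) := by
  have : LocallyCompactSpace Q := Manifold.locallyCompact_of_finiteDimensional (𝓡 m)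
  have : SigmaCompactSpace Q := sigmaCompactSpace_of_locallyCompact_secondCountable
  -- The admissible values of a lift at each point form an affine, hence convex, subset of the
  -- fibre, so local lifts glue by a partition of unity.
  exact exists_contMDiffSection_forall_mem_convex_of_local (I := 𝓡 m) (n := ⊤) E
    (fun x => {e | F x e = X' (f x)})
    (fun x => (convex_singleton (𝕜 := ℝ) (X' (f x))).linear_preimage (F x))
    (fun x₀ => exists_local_lift hF hf (hsurj x₀) X')

end BundleMaps

/-! ### Calculus of directional derivatives -/

section DerivAlong

variable {m : ℕ} {Q : Type*} [TopologicalSpace Q] [ChartedSpace (EuclideanSpace ℝ (Fin m)) Q]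

theorem ContMDiff.mdifferentiableAt_real {f : Q → ℝ} (hf : ContMDiff (𝓡 m) 𝓘(ℝ, ℝ) ∞ f) (x : Q) :
    MDifferentiableAt (𝓡 m) 𝓘(ℝ, ℝ) f x :=
  hf.mdifferentiable (by simp) x

theorem derivAlong_congr {f g : Q → ℝ} {x : Q} (h : f =ᶠ[𝓝 x] g) (v : TangentSpace (𝓡 m) x) :
    derivAlong f v = derivAlong g v := by
  unfold derivAlong
  rw [h.mfderiv_eq]
  rfl

theorem derivAlong_const (c : ℝ) {x : Q} (v : TangentSpace (𝓡 m) x) :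
    derivAlong (fun _ : Q => c) v = 0 := by
  unfold derivAlong
  rw [mfderiv_const]
  rfl

theorem derivAlong_add {f g : Q → ℝ} {x : Q} (hf : MDifferentiableAt (𝓡 m) 𝓘(ℝ, ℝ) f x)
    (hg : MDifferentiableAt (𝓡 m) 𝓘(ℝ, ℝ) g x) (v : TangentSpace (𝓡 m) x) :
    derivAlong (fun y => f y + g y) v = derivAlong f v + derivAlong g v := by
  unfold derivAlong
  have := (hf.hasMFDerivAt.add hg.hasMFDerivAt).mfderiv
  change mfderiv (𝓡 m) 𝓘(ℝ, ℝ) (f + g) x v = _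
  rw [this]
  rfl

theorem derivAlong_sum {ι : Type*} (s : Finset ι) {f : ι → Q → ℝ} {x : Q}
    (hf : ∀ i ∈ s, MDifferentiableAt (𝓡 m) 𝓘(ℝ, ℝ) (f i) x) (v : TangentSpace (𝓡 m) x) :
    derivAlong (fun y => ∑ i ∈ s, f i y) v = ∑ i ∈ s, derivAlong (f i) v := by
  classical
  have : MDifferentiableAt (𝓡 m) 𝓘(ℝ, ℝ) (fun y => ∑ i ∈ s, f i y) x ∧
      derivAlong (fun y => ∑ i ∈ s, f i y) v = ∑ i ∈ s, derivAlong (f i) v := by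
    induction s using Finset.induction_on with
    | empty => simpa using! ⟨mdifferentiableAt_const, derivAlong_const 0 v⟩
    | insert i s hi ih =>
      obtain ⟨h1, h2⟩ := ih fun j hj => hf j (Finset.mem_insert_of_mem hj)
      have h3 := hf i (Finset.mem_insert_self i s)
      simp only [Finset.sum_insert hi]
      exact ⟨h3.add h1, by rw [derivAlong_add h3 h1, h2]⟩
  exact this.2

theorem derivAlong_mul {f g : Q → ℝ} {x : Q} (hf : MDifferentiableAt (𝓡 m) 𝓘(ℝ, ℝ) f x)
    (hg : MDifferentiableAt (𝓡 m) 𝓘(ℝ, ℝ) g x) (v : TangentSpace (𝓡 m) x) :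
    derivAlong (fun y => f y * g y) v = f x * derivAlong g v + g x * derivAlong f v := by
  unfold derivAlong
  have := (hf.hasMFDerivAt.mul hg.hasMFDerivAt).mfderiv
  change mfderiv (𝓡 m) 𝓘(ℝ, ℝ) (f * g) x v = _
  rw [this]
  rfl

theorem derivAlong_prod {k : ℕ} {f : Fin k → Q → ℝ} {x : Q}
    (hf : ∀ i, MDifferentiableAt (𝓡 m) 𝓘(ℝ, ℝ) (f i) x) (v : TangentSpace (𝓡 m) x) :
    derivAlong (fun y => ∏ i, f i y) v =
      ∑ i, ∏ j, if j = i then derivAlong (f j) v else f j x := by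
  have := (HasMFDerivAt.prod (t := Finset.univ) fun i _ => (hf i).hasMFDerivAt).mfderiv
  have h2 : (fun y => ∏ i, f i y) = ∏ i, f i := by ext y; simp
  have h3 : ∀ i, (∏ j, if j = i then derivAlong (f j) v else f j x) =
      (∏ j ∈ Finset.univ.erase i, f j x) * derivAlong (f i) v := fun i => by
    rw [← Finset.mul_prod_erase _ _ (Finset.mem_univ i), if_pos rfl, mul_comm]
    congr 1
    exact Finset.prod_congr rfl fun j hj => if_neg (Finset.ne_of_mem_erase hj)
  refine Eq.trans ?_ (Finset.sum_congr rfl fun i _ => (h3 i).symm)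
  rw [derivAlong, h2, this]
  exact sum_apply (F := EuclideanSpace ℝ (Fin m) →L[ℝ] ℝ) _ _ _

theorem derivAlong_comp {m' : ℕ} {Q' : Type*} [TopologicalSpace Q']
    [ChartedSpace (EuclideanSpace ℝ (Fin m')) Q'] {g : Q' → ℝ} {f : Q → Q'} {x : Q}
    (hg : MDifferentiableAt (𝓡 m') 𝓘(ℝ, ℝ) g (f x)) (hf : MDifferentiableAt (𝓡 m) (𝓡 m') f x)
    (v : TangentSpace (𝓡 m) x) :
    derivAlong (fun y => g (f y)) v = derivAlong g (mfderiv (𝓡 m) (𝓡 m') f x v) := by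
  unfold derivAlong
  exact mfderiv_comp_apply x hg hf v

theorem derivAlong_sum_smul {ι : Type*} (s : Finset ι) (f : Q → ℝ) {x : Q} (c : ι → ℝ)
    (v : ι → TangentSpace (𝓡 m) x) :
    derivAlong f (∑ i ∈ s, c i • v i) = ∑ i ∈ s, c i * derivAlong f (v i) := by
  unfold derivAlong
  rw [map_sum]
  refine Finset.sum_congr rfl fun i _ => ?_
  rw [map_smul]
  rfl

/-- The function is the fibre component of the tangent map of `f` composed with the vector field. -/
theorem contMDiff_derivAlong [IsManifold (𝓡 m) ∞ Q] {f : Q → ℝ}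
    (hf : ContMDiff (𝓡 m) 𝓘(ℝ, ℝ) ∞ f)
    {V : ∀ x : Q, TangentSpace (𝓡 m) x}
    (hV : ContMDiff (𝓡 m) (𝓡 m).tangent ∞ (fun x => (⟨x, V x⟩ : TangentBundle (𝓡 m) Q))) :
    ContMDiff (𝓡 m) 𝓘(ℝ, ℝ) ∞ (fun x => derivAlong f (V x)) := by
  have h := (hf.contMDiff_tangentMap (m := ∞) (by simp)).comp hV
  intro x
  have := (Bundle.contMDiffAt_totalSpace.1 (h x)).2
  simpa only [trivializationAt_model_space_apply] using! this

/-- Tangent vectors are separated by the derivatives of global smooth functions. -/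
theorem eq_of_derivAlong_eq [T2Space Q] [IsManifold (𝓡 m) ∞ Q] {x : Q}
    {v w : TangentSpace (𝓡 m) x}
    (h : ∀ f : Q → ℝ, ContMDiff (𝓡 m) 𝓘(ℝ, ℝ) ∞ f → derivAlong f v = derivAlong f w) : v = w := by
  obtain ⟨χ⟩ : Nonempty (SmoothBumpFunction (𝓡 m) x) := inferInstance
  have hinv : (mfderiv (𝓡 m) 𝓘(ℝ, EuclideanSpace ℝ (Fin m)) (extChartAt (𝓡 m) x) x).IsInvertible :=
    isInvertible_mfderiv_extChartAt (mem_extChartAt_source x)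
  refine hinv.injective (PiLp.ext (p := 2) (α := fun _ : Fin m => ℝ) fun i => ?_)
  have hd : MDifferentiableAt (𝓡 m) 𝓘(ℝ, EuclideanSpace ℝ (Fin m)) (extChartAt (𝓡 m) x) x :=
    mdifferentiableAt_extChartAt (mem_chart_source _ x)
  -- Chart coordinates cut off by a bump function are global test functions, and near `x` they still
  -- compute the components of a tangent vector.
  set f : Q → ℝ := fun y => χ y • (extChartAt (𝓡 m) x y) i with hfdef
  have hf : ContMDiff (𝓡 m) 𝓘(ℝ, ℝ) ∞ f := by
    refine χ.contMDiff_smul (g := fun y => (extChartAt (𝓡 m) x y) i) ?_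
    exact (EuclideanSpace.proj (𝕜 := ℝ) i).contMDiff.comp_contMDiffOn contMDiffOn_extChartAt
  have key : ∀ u : TangentSpace (𝓡 m) x, derivAlong f u =
      EuclideanSpace.proj (𝕜 := ℝ) i
        (mfderiv (𝓡 m) 𝓘(ℝ, EuclideanSpace ℝ (Fin m)) (extChartAt (𝓡 m) x) x u) := by
    intro u
    have h1 : f =ᶠ[𝓝 x] (EuclideanSpace.proj (𝕜 := ℝ) i) ∘ extChartAt (𝓡 m) x := by
      filter_upwards [χ.eventuallyEq_one] with y hy
      simp [hfdef, hy]
    rw [derivAlong_congr h1, derivAlong, mfderiv_comp_apply x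
      (EuclideanSpace.proj (𝕜 := ℝ) i).mdifferentiableAt hd, ContinuousLinearMap.mfderiv_eq]
    rfl
  exact (key v).symm.trans ((h f hf).trans (key w))

end DerivAlong

/-! ### Locality of the bracket and the differential of 1-forms -/

section LieAlgebroid

variable {m n : ℕ} {Q : Type*} [TopologicalSpace Q] [ChartedSpace (EuclideanSpace ℝ (Fin m)) Q]
  {E : Q → Type*} [∀ x, AddCommGroup (E x)] [∀ x, Module ℝ (E x)]
  [∀ x, TopologicalSpace (E x)] [TopologicalSpace (TotalSpace (EuclideanSpace ℝ (Fin n)) E)]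
  [FiberBundle (EuclideanSpace ℝ (Fin n)) E] [VectorBundle ℝ (EuclideanSpace ℝ (Fin n)) E]

theorem Sec.sum_apply {ι : Type*} (s : Finset ι) (X : ι → Sec m n E) (x : Q) :
    (∑ i ∈ s, X i) x = ∑ i ∈ s, X i x := by
  classical
  induction s using Finset.induction_on with
  | empty => simp
  | insert a s ha ih => rw [Finset.sum_insert ha, Finset.sum_insert ha, ← ih]; rfl

/-- The product of a smooth section with a smooth function. -/
noncomputable def Sec.smulFun (Y : Sec m n E) (f : Q → ℝ) (hf : ContMDiff (𝓡 m) 𝓘(ℝ, ℝ) ∞ f) :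
    Sec m n E :=
  ⟨fun y => f y • Y y, hf.smul_section Y.contMDiff⟩

namespace LieAlgebroid

variable [IsManifold (𝓡 m) ∞ Q] (A : LieAlgebroid m n E)

theorem contMDiff_anchor_section (X : Sec m n E) :
    ContMDiff (𝓡 m) (𝓡 m).tangent ∞
      (fun x => (⟨x, A.anchor x (X x)⟩ : TangentBundle (𝓡 m) Q)) :=
  A.contMDiff_anchor.comp X.contMDiff

theorem bracket_antisymm (X Y : Sec m n E) : A.bracket X Y = -A.bracket Y X := by
  have h := A.bracket_self (X + Y)
  simp only [map_add, LinearMap.add_apply, A.bracket_self, zero_add, add_zero] at h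
  exact eq_neg_of_add_eq_zero_right h

theorem bracket_smulFun (X Y : Sec m n E) (f : Q → ℝ) (hf : ContMDiff (𝓡 m) 𝓘(ℝ, ℝ) ∞ f) (x : Q) :
    A.bracket X (Y.smulFun f hf) x =
      f x • A.bracket X Y x + derivAlong f (A.anchor x (X x)) • Y x :=
  A.leibniz X Y f hf x

/-- Locality of the bracket from the Leibniz rule: a bump supported where `Y` vanishes has zero
product with `Y`, and expanding the bracket of `X` with this product at `x` leaves the bracket of
`X` and `Y`. -/
theorem bracket_eq_zero_of_eventuallyEq [T2Space Q] (X : Sec m n E) {Y : Sec m n E} {x : Q}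
    (hY : ∀ᶠ y in 𝓝 x, Y y = 0) : A.bracket X Y x = 0 := by
  obtain ⟨χ, -, hχ⟩ := (SmoothBumpFunction.nhds_basis_tsupport (I := 𝓡 m) x).mem_iff.1 hY
  have h0 : Y.smulFun χ χ.contMDiff = 0 := by
    ext y
    change χ y • Y y = 0
    by_cases hy : y ∈ tsupport χ
    · rw [show Y y = 0 from hχ hy, smul_zero]
    · rw [image_eq_zero_of_notMem_tsupport hy, zero_smul]
  have h := A.bracket_smulFun X Y χ χ.contMDiff x
  rw [h0, map_zero, show Y x = 0 from hY.self_of_nhds, smul_zero, add_zero, χ.eq_one,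
    one_smul] at h
  exact h.symm

/-- The bracket with a section given near `x` by an expansion with smooth coefficients. -/
theorem bracket_apply_of_eventuallyEq_sum [T2Space Q] (X W : Sec m n E) {ι : Type*} [Fintype ι]
    (Z : ι → Sec m n E) {g : ι → Q → ℝ} (hg : ∀ a, ContMDiff (𝓡 m) 𝓘(ℝ, ℝ) ∞ (g a)) {x : Q}
    (hW : ∀ᶠ y in 𝓝 x, W y = ∑ a, g a y • Z a y) :
    A.bracket X W x = ∑ a, (g a x • A.bracket X (Z a) x +
      derivAlong (g a) (A.anchor x (X x)) • Z a x) := by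
  have h : A.bracket X (W - ∑ a, (Z a).smulFun (g a) (hg a)) x = 0 := by
    refine A.bracket_eq_zero_of_eventuallyEq X ?_
    filter_upwards [hW] with y hy
    change W y - (∑ a, (Z a).smulFun (g a) (hg a)) y = 0
    rw [hy, Sec.sum_apply, sub_eq_zero]
    rfl
  rw [map_sub, map_sum] at h
  change A.bracket X W x - (∑ a, A.bracket X ((Z a).smulFun (g a) (hg a))) x = 0 at h
  rw [sub_eq_zero.1 h, Sec.sum_apply]
  exact Finset.sum_congr rfl fun a _ => A.bracket_smulFun X (Z a) (g a) (hg a) x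

theorem differential_zero (μ : FibreForm E 0) (X : Fin 1 → Sec m n E) (x : Q) :
    A.differential μ X x = derivAlong (fun y => μ y ![]) (A.anchor x (X 0 x)) := by
  simp [LieAlgebroid.differential, LieAlgebroid.bracketTerm]
  congr! 2 with y
  exact congrArg _ (Subsingleton.elim _ _)

theorem differential_one (μ : FibreForm E 1) (X : Fin 2 → Sec m n E) (x : Q) :
    A.differential μ X x =
      derivAlong (fun y => μ y ![X 1 y]) (A.anchor x (X 0 x)) -
        derivAlong (fun y => μ y ![X 0 y]) (A.anchor x (X 1 x)) -
        μ x ![A.bracket (X 0) (X 1) x] := by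
  have e : ∀ (y : Q) (v : Fin 1 → E y), v = ![v 0] := fun y v => by
    ext i; fin_cases i; rfl
  have e0 : ∀ y, (fun l => (0 : Fin 2).removeNth X l y) = ![X 1 y] := fun y => e y _
  have e1 : ∀ y, (fun l => (1 : Fin 2).removeNth X l y) = ![X 0 y] := fun y => e y _
  have e2 : (Fin.cons (A.bracket (X 0) (X 1) x)
      (fun l => (0 : Fin 1).removeNth ((1 : Fin 2).removeNth X) l x) : Fin 1 → E x) =
      ![A.bracket (X 0) (X 1) x] := e x _
  have h : A.differential μ X x = (∑ i : Fin 2, (-1 : ℝ) ^ i.val *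
        derivAlong (fun y => μ y (fun l => i.removeNth X l y)) (A.anchor x (X i x))) +
      ∑ j : Fin 2, ∑ i : Fin 1, if i.castSucc < j then (-1 : ℝ) ^ (i.val + j.val) *
        μ x (Fin.cons (A.bracket (X i.castSucc) (X j) x)
          (fun l => i.removeNth (j.removeNth X) l x)) else 0 := rfl
  rw [h]
  simp only [Fin.sum_univ_two, e0, e1, Finset.univ_unique, Finset.sum_singleton,
    Fin.default_eq_zero, Fin.castSucc_zero]
  rw [if_neg (lt_irrefl _), if_pos (by decide), e2]
  simp
  ring

/-- Antisymmetry transfers tensoriality from the second argument to the first. -/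
theorem differential_one_swap (μ : FibreForm E 1) (X Y : Sec m n E) (x : Q) :
    A.differential μ ![X, Y] x = -A.differential μ ![Y, X] x := by
  rw [differential_one, differential_one]
  simp only [Matrix.cons_val_zero, Matrix.cons_val_one]
  rw [A.bracket_antisymm X Y]
  have : μ x ![(-A.bracket Y X : Sec m n E) x] = -μ x ![A.bracket Y X x] := by
    rw [← AlternatingMap.linearOne_apply, ← AlternatingMap.linearOne_apply]
    exact (μ x).linearOne.map_neg (A.bracket Y X x)
  rw [this]
  ring

end LieAlgebroid

/-- The alternating `2`-form defined by an alternating bilinear form. -/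
def LinearMap.IsAlt.toAlternatingMapTwo {V : Type*} [AddCommGroup V] [Module ℝ V]
    {B : V →ₗ[ℝ] V →ₗ[ℝ] ℝ} (hB : B.IsAlt) : V [⋀^Fin 2]→ₗ[ℝ] ℝ where
  toFun v := B (v 0) (v 1)
  map_update_add' {inst} v i x y := by
    obtain rfl := Subsingleton.elim inst (instDecidableEqFin 2)
    fin_cases i <;> simp
  map_update_smul' {inst} v i c x := by
    obtain rfl := Subsingleton.elim inst (instDecidableEqFin 2)
    fin_cases i <;> simp
  map_eq_zero_of_eq' v i j hv hij := by
    have h : v 0 = v 1 := by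
      fin_cases i <;> fin_cases j <;> simp_all
    rw [h]
    exact hB (v 1)

namespace LieAlgebroid

variable [IsManifold (𝓡 m) ∞ Q] [T2Space Q]
  (A : LieAlgebroid m n E)

/-- Tensoriality in the second argument: the derivatives of the coefficients of `W` along the anchor
of `X` occur once in the term differentiating `μ(W)` and once, with opposite sign, in the bracket
term. -/
theorem differential_one_right {μ : FibreForm E 1} (hμ : μ.IsSmooth m n) (X W : Sec m n E) {x : Q}
    (Z : SectionFrame m n E x) :
    A.differential μ ![X, W] x =
      ∑ a, Z.coord a x (W x) * A.differential μ ![X, Z.sec a] x := by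
  have hW : ∀ᶠ y in 𝓝 x, W y = ∑ a, Z.coord a y (W y) • Z.sec a y :=
    Z.eventually_sum.mono fun y hy => hy (W y)
  have hg : ∀ a, ContMDiff (𝓡 m) 𝓘(ℝ, ℝ) ∞ (fun y => Z.coord a y (W y)) := fun a =>
    (Z.contMDiff_coord a).comp W.contMDiff
  have hlin : ∀ (y : Q) (c : Fin n → ℝ) (v : Fin n → E y),
      μ y ![∑ a, c a • v a] = ∑ a, c a * μ y ![v a] := fun y c v => by
    simp_rw [← AlternatingMap.linearOne_apply, map_sum, map_smul, smul_eq_mul]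
  have hs := hμ.contMDiff_one
  simp only [differential_one, Matrix.cons_val_zero, Matrix.cons_val_one]
  have h1 : (fun y => μ y ![W y]) =ᶠ[𝓝 x]
      fun y => ∑ a, Z.coord a y (W y) * μ y ![Z.sec a y] := by
    filter_upwards [hW] with y hy
    conv_lhs => rw [hy]
    rw [hlin]
  rw [derivAlong_congr h1, derivAlong_sum _ (f := fun a y => Z.coord a y (W y) * μ y ![Z.sec a y])
    (fun a _ => ((hg a).mul (hs (Z.sec a))).mdifferentiableAt_real x)]
  rw [A.bracket_apply_of_eventuallyEq_sum X W Z.sec hg hW]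
  have h2 : μ x ![∑ a, (Z.coord a x (W x) • A.bracket X (Z.sec a) x +
      derivAlong (fun y => Z.coord a y (W y)) (A.anchor x (X x)) • Z.sec a x)] =
      ∑ a, (Z.coord a x (W x) * μ x ![A.bracket X (Z.sec a) x] +
        derivAlong (fun y => Z.coord a y (W y)) (A.anchor x (X x)) * μ x ![Z.sec a x]) := by
    simp_rw [← AlternatingMap.linearOne_apply, map_sum, map_add, map_smul, smul_eq_mul]
  have h3 : A.anchor x (W x) = ∑ a, Z.coord a x (W x) • A.anchor x (Z.sec a x) := by
    conv_lhs => rw [hW.self_of_nhds]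
    simp
  rw [h2, h3, derivAlong_sum_smul, ← Finset.sum_sub_distrib, ← Finset.sum_sub_distrib]
  refine Finset.sum_congr rfl fun a _ => ?_
  rw [derivAlong_mul ((hg a).mdifferentiableAt_real x) ((hs _).mdifferentiableAt_real x)]
  ring

theorem differential_one_apply {μ : FibreForm E 1} (hμ : μ.IsSmooth m n) (X Y : Sec m n E) {x : Q}
    (Z : SectionFrame m n E x) :
    A.differential μ ![X, Y] x = ∑ a, ∑ b, Z.coord a x (X x) * Z.coord b x (Y x) *
      A.differential μ ![Z.sec a, Z.sec b] x := by
  rw [A.differential_one_swap, A.differential_one_right hμ Y X Z, ← Finset.sum_neg_distrib]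
  refine Finset.sum_congr rfl fun a _ => ?_
  rw [A.differential_one_swap, mul_neg, neg_neg, A.differential_one_right hμ _ Y Z, Finset.mul_sum]
  exact Finset.sum_congr rfl fun b _ => by ring

variable [ContMDiffVectorBundle ∞ (EuclideanSpace ℝ (Fin n)) E (𝓡 m)]

/-- Every smooth `1`-form has a smooth differential. -/
theorem exists_isDifferential_one {μ : FibreForm E 1} (hμ : μ.IsSmooth m n) :
    ∃ ψ : FibreForm E 2, ψ.IsSmooth m n ∧ A.IsDifferential μ ψ := by
  have Z : ∀ x, SectionFrame m n E x := fun x => (SectionFrame.nonempty x).some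
  -- A frame is chosen independently at each point, with no continuity in the choice. By
  -- tensoriality the values on sections do not depend on it, and smoothness is read off from
  -- Cartan's formula instead.
  set B : ∀ x, E x →ₗ[ℝ] E x →ₗ[ℝ] ℝ := fun x => ∑ a, ∑ b,
    A.differential μ ![(Z x).sec a, (Z x).sec b] x •
      (LinearMap.mul ℝ ℝ).compl₁₂ ((Z x).coord a x) ((Z x).coord b x) with hB
  have hBX : ∀ (X Y : Sec m n E) x, B x (X x) (Y x) = A.differential μ ![X, Y] x := by
    intro X Y x
    rw [A.differential_one_apply hμ X Y (Z x)]
    simp only [hB, LinearMap.sum_apply, LinearMap.smul_apply, LinearMap.compl₁₂_apply,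
      LinearMap.mul_apply', smul_eq_mul]
    exact Finset.sum_congr rfl fun a _ => Finset.sum_congr rfl fun b _ => by ring
  have halt : ∀ x, (B x).IsAlt := fun x e => by
    obtain ⟨X, rfl⟩ := exists_sec_apply_eq (m := m) (n := n) e
    have h := A.differential_one_swap μ X X x
    rw [hBX]
    linarith
  have hd : A.IsDifferential μ fun x => (halt x).toAlternatingMapTwo := fun X x => by
    have h := hBX (X 0) (X 1) x
    have hX : ![X 0, X 1] = X := by ext i; fin_cases i <;> rfl
    rw [hX] at h
    exact h
  refine ⟨_, fun X => ?_, hd⟩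
  have hs := hμ.contMDiff_one
  simp_rw [hd X, differential_one]
  exact ((contMDiff_derivAlong (hs _) (A.contMDiff_anchor_section _)).sub
    (contMDiff_derivAlong (hs _) (A.contMDiff_anchor_section _))).sub (hs _)

end LieAlgebroid

end LieAlgebroid

/-! ### Combinatorics of Cartan's formula -/

section AlternatingAlgebra

theorem AlternatingMap.map_update_eq_insertNth {V : Type*} [AddCommGroup V] [Module ℝ V] {k : ℕ}
    (φ : V [⋀^Fin (k + 1)]→ₗ[ℝ] ℝ) (W : Fin (k + 1) → V) (l : Fin (k + 1)) (u : V) :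
    φ (Function.update W l u) = (-1 : ℝ) ^ l.val * φ.curryLeft u (l.removeNth W) := by
  rw [← Fin.insertNth_removeNth, φ.map_insertNth]
  simp

/-- In Cartan's formula, the terms that differentiate the coefficients of the arguments cancel. -/
theorem AlternatingMap.sum_update_add_sum_cons_eq_zero {V : Type*} [AddCommGroup V] [Module ℝ V]
    {k : ℕ} (φ : V [⋀^Fin (k + 1)]→ₗ[ℝ] ℝ) (W : Fin (k + 2) → V)
    (N : Fin (k + 2) → Fin (k + 2) → V) :
    ∑ i : Fin (k + 2), (-1 : ℝ) ^ i.val *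
        ∑ l : Fin (k + 1), φ (Function.update (i.removeNth W) l (N i (i.succAbove l))) +
      ∑ j : Fin (k + 2), ∑ i : Fin (k + 1), (if i.castSucc < j then
        (-1 : ℝ) ^ (i.val + j.val) *
          φ.curryLeft (N i.castSucc j - N j i.castSucc) (i.removeNth (j.removeNth W)) else 0) = 0 := by
  simp_rw [φ.map_update_eq_insertNth, Finset.mul_sum]
  -- Ordered pairs of distinct slots are grouped into unordered pairs `{i, j + 1}` with `i ≤ j`.
  -- Deleting the two slots in either order leaves the same arguments (`h3`), and the signs then
  -- cancel pair by pair.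
  rw [Fin.sum_sum_eq_sum_triangle_add, Fin.sum_sum_eq_sum_triangle_add, ← Finset.sum_add_distrib]
  refine Finset.sum_eq_zero fun i _ => ?_
  rw [← Finset.sum_add_distrib]
  refine Finset.sum_eq_zero fun j hj => ?_
  rw [Finset.mem_Ici] at hj
  have h1 : i.castSucc.succAbove j = j.succ := Fin.succAbove_of_le_castSucc _ _ (by simpa using hj)
  have h2 : j.succ.succAbove i = i.castSucc :=
    Fin.succAbove_of_castSucc_lt _ _ (Fin.castSucc_lt_succ_iff.2 hj)
  have h3 : j.removeNth (i.castSucc.removeNth W) = i.removeNth (j.succ.removeNth W) := by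
    rw [Fin.removeNth_removeNth_eq_swap]
    simp [Fin.predAbove, not_lt.2 hj, Fin.succAbove]
  have h4 : ¬ j.castSucc < i.castSucc := by simpa using hj
  have h5 : i.castSucc < j.succ := Fin.castSucc_lt_succ_iff.2 hj
  rw [h1, h2, h3, if_neg h4, if_pos h5, map_sub, AlternatingMap.sub_apply]
  simp only [Fin.val_castSucc, Fin.val_succ]
  ring

theorem Fin.sum_pi_insertNth {N : Type*} [Fintype N] {k : ℕ} (i : Fin (k + 1))
    (G : (Fin (k + 1) → N) → ℝ) :
    ∑ a, G a = ∑ b, ∑ a' : Fin k → N, G (i.insertNth b a') := by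
  rw [← (Fin.insertNthEquiv (fun _ => N) i).sum_comp, Fintype.sum_prod_type]
  rfl

theorem AlternatingMap.finsetSum_apply {V ι : Type*} [AddCommGroup V] [Module ℝ V] {k : ℕ}
    (s : Finset ι) (f : ι → V [⋀^Fin k]→ₗ[ℝ] ℝ) (v : Fin k → V) :
    (∑ i ∈ s, f i) v = ∑ i ∈ s, f i v := by
  classical
  induction s using Finset.induction_on with
  | empty => simp
  | insert i s hi ih =>
    rw [Finset.sum_insert hi, Finset.sum_insert hi, AlternatingMap.add_apply, ih]

/-- This expands a bracket term in a frame, with `B` the brackets of frame elements: a multi-index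
splits into its values at the two bracketed slots and the rest. -/
theorem AlternatingMap.curryLeft_sum_sum_smul {V : Type*} [AddCommGroup V] [Module ℝ V] {k n : ℕ}
    (φ : V [⋀^Fin (k + 1)]→ₗ[ℝ] ℝ) (g : Fin (k + 2) → Fin n → ℝ) (y : Fin n → V)
    (B : Fin n → Fin n → V) {i : Fin (k + 1)} {j : Fin (k + 2)} (hij : i.castSucc < j) :
    φ.curryLeft (∑ p, ∑ q, (g i.castSucc p * g j q) • B p q)
        (i.removeNth (j.removeNth fun l => ∑ a, g l a • y a)) =
      ∑ a : Fin (k + 2) → Fin n, (∏ l, g l (a l)) *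
        φ.curryLeft (B (a i.castSucc) (a j)) (i.removeNth (j.removeNth fun l => y (a l))) := by
  have h : j.succAbove i = i.castSucc := Fin.succAbove_of_castSucc_lt _ _ hij
  rw [Fin.sum_pi_insertNth j]
  simp_rw [Fin.sum_pi_insertNth i]
  rw [Finset.sum_comm]
  simp only [map_sum, map_smul, AlternatingMap.finsetSum_apply, AlternatingMap.smul_apply, smul_eq_mul]
  refine Finset.sum_congr rfl fun q _ => Finset.sum_congr rfl fun p _ => ?_
  have := (φ.curryLeft (B p q)).map_fun_sum_smul
    (fun l => g (j.succAbove (i.succAbove l))) y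
  refine (congrArg (g i.castSucc p * g j q * ·) this).trans ?_
  rw [Finset.mul_sum]
  refine Finset.sum_congr rfl fun a _ => ?_
  have hr : i.removeNth (j.removeNth fun l => y ((j.insertNth q (i.insertNth p a) :
      Fin (k + 2) → Fin n) l)) = fun l => y (a l) := by
    funext l
    simp [Fin.removeNth]
  rw [Fin.prod_univ_succAbove _ j, Fin.prod_univ_succAbove _ i, ← h, hr]
  simp only [Fin.insertNth_apply_same, Fin.insertNth_apply_succAbove]
  ring

end AlternatingAlgebra

/-! ### A criterion for Lie algebroid morphisms -/

section MorphismCriterion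

variable {m n m' n' : ℕ}
  {Q : Type*} [TopologicalSpace Q] [ChartedSpace (EuclideanSpace ℝ (Fin m)) Q]
  {E : Q → Type*} [∀ x, AddCommGroup (E x)] [∀ x, Module ℝ (E x)]
  [∀ x, TopologicalSpace (E x)] [TopologicalSpace (TotalSpace (EuclideanSpace ℝ (Fin n)) E)]
  [FiberBundle (EuclideanSpace ℝ (Fin n)) E]
  {Q' : Type*} [TopologicalSpace Q'] [ChartedSpace (EuclideanSpace ℝ (Fin m')) Q']
  {E' : Q' → Type*} [∀ x, AddCommGroup (E' x)] [∀ x, Module ℝ (E' x)]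
  [∀ x, TopologicalSpace (E' x)] [TopologicalSpace (TotalSpace (EuclideanSpace ℝ (Fin n')) E')]
  [FiberBundle (EuclideanSpace ℝ (Fin n')) E']
  {f : Q → Q'} {F : ∀ x, E x →ₗ[ℝ] E' (f x)}

namespace SectionFrame

variable {x₀ : Q} (Y : SectionFrame m' n' E' (f x₀))

/-- The coefficient functions of the image of a section under a bundle map. -/
noncomputable def mapCoeff (F : ∀ x, E x →ₗ[ℝ] E' (f x)) (X : Sec m n E) (b : Fin n') (x : Q) : ℝ :=
  Y.coord b (f x) (F x (X x))

/-- The derivative, with respect to the flat connection for which the frame is parallel, of the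
image of a section under a bundle map. -/
noncomputable def flatDeriv (F : ∀ x, E x →ₗ[ℝ] E' (f x)) (X : Sec m n E) (v : TangentSpace (𝓡 m) x₀) :
    E' (f x₀) :=
  ∑ b, derivAlong (Y.mapCoeff F X b) v • Y.sec b (f x₀)

theorem contMDiff_mapCoeff
    (hF : ContMDiff ((𝓡 m).prod 𝓘(ℝ, EuclideanSpace ℝ (Fin n)))
      ((𝓡 m').prod 𝓘(ℝ, EuclideanSpace ℝ (Fin n'))) ∞
      (fun p : TotalSpace (EuclideanSpace ℝ (Fin n)) E =>
        (⟨f p.1, F p.1 p.2⟩ : TotalSpace (EuclideanSpace ℝ (Fin n')) E'))) (X : Sec m n E)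
    (b : Fin n') : ContMDiff (𝓡 m) 𝓘(ℝ, ℝ) ∞ (Y.mapCoeff F X b) :=
  (Y.contMDiff_coord b).comp (hF.comp X.contMDiff)

theorem map_eq_sum (X : Sec m n E) :
    F x₀ (X x₀) = ∑ b, Y.mapCoeff F X b x₀ • Y.sec b (f x₀) :=
  Y.sum_coord _

theorem eventually_map_eq_sum (hf : ContMDiff (𝓡 m) (𝓡 m') ∞ f) (X : Sec m n E) :
    ∀ᶠ x in 𝓝 x₀, F x (X x) = ∑ b, Y.mapCoeff F X b x • Y.sec b (f x) :=
  (hf.continuous.continuousAt.eventually Y.eventually_sum).mono fun _ h => h _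

/-- Leibniz rule for the frame expansion of the arguments: the first sum differentiates the
coefficients, the second the values of `φ` on the frame. Only the second has a counterpart in the
differential on the target. -/
theorem derivAlong_pullback (hf : ContMDiff (𝓡 m) (𝓡 m') ∞ f)
    (hF : ContMDiff ((𝓡 m).prod 𝓘(ℝ, EuclideanSpace ℝ (Fin n)))
      ((𝓡 m').prod 𝓘(ℝ, EuclideanSpace ℝ (Fin n'))) ∞
      (fun p : TotalSpace (EuclideanSpace ℝ (Fin n)) E =>
        (⟨f p.1, F p.1 p.2⟩ : TotalSpace (EuclideanSpace ℝ (Fin n')) E')))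
    {k : ℕ} {φ : FibreForm E' k} (hφ : φ.IsSmooth m' n') (X : Fin k → Sec m n E)
    (v : TangentSpace (𝓡 m) x₀) :
    derivAlong (fun x => φ (f x) (fun l => F x (X l x))) v =
      ∑ l, φ (f x₀) (Function.update (fun l => F x₀ (X l x₀)) l (Y.flatDeriv F (X l) v)) +
      ∑ a : Fin k → Fin n', (∏ l, Y.mapCoeff F (X l) (a l) x₀) *
        derivAlong (fun y => φ y (fun l => Y.sec (a l) y)) (mfderiv (𝓡 m) (𝓡 m') f x₀ v) := by
  have hg : ∀ l b, ContMDiff (𝓡 m) 𝓘(ℝ, ℝ) ∞ (Y.mapCoeff F (X l) b) := fun l b =>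
    Y.contMDiff_mapCoeff hF (X l) b
  have hs : ∀ a : Fin k → Fin n', ContMDiff (𝓡 m') 𝓘(ℝ, ℝ) ∞
      (fun y => φ y (fun l => Y.sec (a l) y)) := fun a => hφ fun l => Y.sec (a l)
  have h1 : (fun x => φ (f x) (fun l => F x (X l x))) =ᶠ[𝓝 x₀] fun x =>
      ∑ a : Fin k → Fin n', (∏ l, Y.mapCoeff F (X l) (a l) x) *
        φ (f x) (fun l => Y.sec (a l) (f x)) := by
    filter_upwards [Filter.eventually_all.2 fun l => Y.eventually_map_eq_sum (F := F) hf (X l)]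
      with x hx
    rw [← AlternatingMap.map_fun_sum_smul (φ (f x)) (fun l b => Y.mapCoeff F (X l) b x)
      (fun b => Y.sec b (f x))]
    exact congrArg _ (funext hx)
  have hp : ∀ a : Fin k → Fin n', ContMDiff (𝓡 m) 𝓘(ℝ, ℝ) ∞
      (fun x => ∏ l, Y.mapCoeff F (X l) (a l) x) := fun a =>
    contMDiff_finsetProd fun l _ => hg l (a l)
  rw [derivAlong_congr h1, derivAlong_sum _
    (f := fun a x => (∏ l, Y.mapCoeff F (X l) (a l) x) * φ (f x) (fun l => Y.sec (a l) (f x)))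
    (fun a _ => ((hp a).mul ((hs a).comp hf)).mdifferentiableAt_real x₀)]
  have h2 : ∀ l, φ (f x₀)
      (Function.update (fun l => F x₀ (X l x₀)) l (Y.flatDeriv F (X l) v)) =
      ∑ a : Fin k → Fin n', (∏ j, if j = l then derivAlong (Y.mapCoeff F (X j) (a j)) v
        else Y.mapCoeff F (X j) (a j) x₀) * φ (f x₀) (fun l => Y.sec (a l) (f x₀)) := by
    intro l
    rw [← AlternatingMap.map_fun_sum_smul (φ (f x₀)) (fun j b =>
      if j = l then derivAlong (Y.mapCoeff F (X j) b) v else Y.mapCoeff F (X j) b x₀)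
      (fun b => Y.sec b (f x₀))]
    congr 1
    funext j
    by_cases hj : j = l
    · subst hj
      simp [flatDeriv]
    · simp only [Function.update_of_ne hj, if_neg hj]
      exact Y.map_eq_sum (X j)
  simp_rw [h2]
  rw [Finset.sum_comm, ← Finset.sum_add_distrib]
  refine Finset.sum_congr rfl fun a _ => ?_
  rw [derivAlong_mul (f := fun x => ∏ l, Y.mapCoeff F (X l) (a l) x)
    (g := fun x => φ (f x) (fun l => Y.sec (a l) (f x))) ((hp a).mdifferentiableAt_real x₀)
    (((hs a).comp hf).mdifferentiableAt_real x₀), derivAlong_prod fun l =>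
      (hg l (a l)).mdifferentiableAt_real x₀]
  have h3 := derivAlong_comp ((hs a).mdifferentiableAt_real (f x₀))
    (hf.mdifferentiable (by simp) x₀) v
  rw [← Finset.sum_mul, h3]
  ring

variable [IsManifold (𝓡 m) ∞ Q] [VectorBundle ℝ (EuclideanSpace ℝ (Fin n)) E]
  [IsManifold (𝓡 m') ∞ Q'] [VectorBundle ℝ (EuclideanSpace ℝ (Fin n')) E']
  {A : LieAlgebroid m n E} {A' : LieAlgebroid m' n' E'}

theorem mfderiv_anchor_eq_sum
    (hanchor : ∀ x e, mfderiv (𝓡 m) (𝓡 m') f x (A.anchor x e) = A'.anchor (f x) (F x e))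
    (X : Sec m n E) :
    mfderiv (𝓡 m) (𝓡 m') f x₀ (A.anchor x₀ (X x₀)) =
      ∑ b, Y.mapCoeff F X b x₀ • A'.anchor (f x₀) (Y.sec b (f x₀)) := by
  rw [hanchor, Y.map_eq_sum]
  simp

/-- By `hsep` it suffices to apply separating 1-forms `σ` to both sides. For such `σ`, the
differential of the pull-back is computed twice, by Cartan's formula on the source and by pulling
back `ψ`; the anchor terms agree by `hanchor`, leaving the bracket identity. -/
theorem map_bracket [T2Space Q'] [ContMDiffVectorBundle ∞ (EuclideanSpace ℝ (Fin n')) E' (𝓡 m')]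
    (hf : ContMDiff (𝓡 m) (𝓡 m') ∞ f)
    (hF : ContMDiff ((𝓡 m).prod 𝓘(ℝ, EuclideanSpace ℝ (Fin n)))
      ((𝓡 m').prod 𝓘(ℝ, EuclideanSpace ℝ (Fin n'))) ∞
      (fun p : TotalSpace (EuclideanSpace ℝ (Fin n)) E =>
        (⟨f p.1, F p.1 p.2⟩ : TotalSpace (EuclideanSpace ℝ (Fin n')) E')))
    (hanchor : ∀ x e, mfderiv (𝓡 m) (𝓡 m') f x (A.anchor x e) = A'.anchor (f x) (F x e))
    (hsep : ∀ e : E' (f x₀), (∀ (σ : FibreForm E' 1) (ψ : FibreForm E' 2), σ.IsSmooth m' n' →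
      A'.IsDifferential σ ψ → A.IsDifferential (σ.pullback F) (ψ.pullback F) →
      σ (f x₀) ![e] = 0) → e = 0)
    (X₁ X₂ : Sec m n E) :
    F x₀ (A.bracket X₁ X₂ x₀) =
      ∑ p, ∑ q, (Y.mapCoeff F X₁ p x₀ * Y.mapCoeff F X₂ q x₀) •
        A'.bracket (Y.sec p) (Y.sec q) (f x₀) +
      (Y.flatDeriv F X₂ (A.anchor x₀ (X₁ x₀)) - Y.flatDeriv F X₁ (A.anchor x₀ (X₂ x₀))) := by
  rw [← sub_eq_zero]
  refine hsep _ fun σ ψ hσ hψ hψ' => ?_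
  have h1 : A.differential (σ.pullback F) ![X₁, X₂] x₀ =
      ∑ p, ∑ q, Y.mapCoeff F X₁ p x₀ * Y.mapCoeff F X₂ q x₀ *
        A'.differential σ ![Y.sec p, Y.sec q] (f x₀) := by
    rw [← hψ' ![X₁, X₂] x₀]
    have h : (fun i => F x₀ (![X₁, X₂] i x₀)) =
        fun i => ∑ b, Y.mapCoeff F (![X₁, X₂] i) b x₀ • Y.sec b (f x₀) :=
      funext fun i => Y.map_eq_sum _
    change ψ (f x₀) (fun i => F x₀ (![X₁, X₂] i x₀)) = _
    rw [h, AlternatingMap.map_fun_sum_smul, ← (finTwoArrowEquiv (Fin n')).symm.sum_comp,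
      Fintype.sum_prod_type]
    refine Finset.sum_congr rfl fun p _ => Finset.sum_congr rfl fun q _ => ?_
    rw [← hψ ![Y.sec p, Y.sec q] (f x₀), Fin.prod_univ_two]
    congr 2
    funext i
    fin_cases i <;> rfl
  have h2 : ∀ X₁ X₂ : Sec m n E,
      derivAlong (fun x => σ (f x) ![F x (X₂ x)]) (A.anchor x₀ (X₁ x₀)) =
      (σ (f x₀)).linearOne (Y.flatDeriv F X₂ (A.anchor x₀ (X₁ x₀))) +
      ∑ p, ∑ q, Y.mapCoeff F X₁ p x₀ * Y.mapCoeff F X₂ q x₀ *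
        derivAlong (fun y => σ y ![Y.sec q y]) (A'.anchor (f x₀) (Y.sec p (f x₀))) := by
    intro X₁ X₂
    have e1 : ∀ (y : Q') (v : Fin 1 → E' y), v = ![v 0] := fun y v => by
      ext i; fin_cases i; rfl
    have h := Y.derivAlong_pullback hf hF hσ ![X₂] (A.anchor x₀ (X₁ x₀))
    rw [Y.mfderiv_anchor_eq_sum hanchor] at h
    simp_rw [e1 _ (fun l => F _ (![X₂] l _)), e1 _ (fun l => Y.sec _ _)] at h
    rw [← (Equiv.funUnique (Fin 1) (Fin n')).symm.sum_comp, Fin.sum_univ_one] at h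
    rw [AlternatingMap.linearOne_apply]
    refine h.trans ?_
    congr 1
    · exact congrArg _ (by rw [e1 _ (Function.update _ _ _)]; simp)
    · rw [Finset.sum_comm]
      refine Finset.sum_congr rfl fun q _ => ?_
      rw [derivAlong_sum_smul, Finset.mul_sum]
      refine Finset.sum_congr rfl fun p _ => ?_
      simp
      ring
  have h3 : A.differential (σ.pullback F) ![X₁, X₂] x₀ =
      derivAlong (fun x => σ (f x) ![F x (X₂ x)]) (A.anchor x₀ (X₁ x₀)) -
      derivAlong (fun x => σ (f x) ![F x (X₁ x)]) (A.anchor x₀ (X₂ x₀)) -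
      (σ (f x₀)).linearOne (F x₀ (A.bracket X₁ X₂ x₀)) := by
    have e1 : ∀ (x : Q) (e : E x), σ.pullback F x ![e] = σ (f x) ![F x e] := fun x e =>
      congrArg (σ (f x)) (by ext i; fin_cases i; rfl)
    rw [A.differential_one]
    simp only [e1, Matrix.cons_val_zero, Matrix.cons_val_one, AlternatingMap.linearOne_apply]
  rw [h3, h2, h2] at h1
  simp only [A'.differential_one, Matrix.cons_val_zero, Matrix.cons_val_one] at h1
  rw [← AlternatingMap.linearOne_apply]
  simp only [map_sub, map_add, map_sum, map_smul, smul_eq_mul]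
  have h4 : ∑ p, ∑ q, Y.mapCoeff F X₂ p x₀ * Y.mapCoeff F X₁ q x₀ *
        derivAlong (fun y => σ y ![Y.sec q y]) (A'.anchor (f x₀) (Y.sec p (f x₀))) =
      ∑ p, ∑ q, Y.mapCoeff F X₁ p x₀ * Y.mapCoeff F X₂ q x₀ *
        derivAlong (fun y => σ y ![Y.sec p y]) (A'.anchor (f x₀) (Y.sec q (f x₀))) := by
    rw [Finset.sum_comm]
    exact Finset.sum_congr rfl fun p _ => Finset.sum_congr rfl fun q _ => by ring
  rw [h4] at h1
  simp only [mul_sub, Finset.sum_sub_distrib, ← AlternatingMap.linearOne_apply] at h1 ⊢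
  linarith

end SectionFrame

/-- A smooth bundle map is a Lie algebroid morphism if it is compatible with the anchors and if the
fibres of the target are separated by `1`-forms whose pull-back commutes with the differentials. -/
theorem isLieAlgebroidMorphism_of_separating [T2Space Q']
    [IsManifold (𝓡 m) ∞ Q] [VectorBundle ℝ (EuclideanSpace ℝ (Fin n)) E]
    [IsManifold (𝓡 m') ∞ Q'] [VectorBundle ℝ (EuclideanSpace ℝ (Fin n')) E']
    [ContMDiffVectorBundle ∞ (EuclideanSpace ℝ (Fin n')) E' (𝓡 m')]
    {A : LieAlgebroid m n E} {A' : LieAlgebroid m' n' E'}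
    (hf : ContMDiff (𝓡 m) (𝓡 m') ∞ f)
    (hF : ContMDiff ((𝓡 m).prod 𝓘(ℝ, EuclideanSpace ℝ (Fin n)))
      ((𝓡 m').prod 𝓘(ℝ, EuclideanSpace ℝ (Fin n'))) ∞
      (fun p : TotalSpace (EuclideanSpace ℝ (Fin n)) E =>
        (⟨f p.1, F p.1 p.2⟩ : TotalSpace (EuclideanSpace ℝ (Fin n')) E')))
    (hanchor : ∀ x e, mfderiv (𝓡 m) (𝓡 m') f x (A.anchor x e) = A'.anchor (f x) (F x e))
    (hsep : ∀ x, ∀ e : E' (f x), (∀ (σ : FibreForm E' 1) (ψ : FibreForm E' 2), σ.IsSmooth m' n' →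
      A'.IsDifferential σ ψ → A.IsDifferential (σ.pullback F) (ψ.pullback F) →
      σ (f x) ![e] = 0) → e = 0) :
    IsLieAlgebroidMorphism A A' f F := by
  refine ⟨hf, hF, fun k φ ψ hφ _ hψ X x₀ => ?_⟩
  obtain ⟨Y⟩ := SectionFrame.nonempty (m := m') (n := n') (E := E') (f x₀)
  set g : Fin (k + 1) → Fin n' → ℝ := fun i b => Y.mapCoeff F (X i) b x₀ with hg
  set W : Fin (k + 1) → E' (f x₀) := fun i => F x₀ (X i x₀) with hW
  have hWsum : W = fun i => ∑ b, g i b • Y.sec b (f x₀) := funext fun i => Y.map_eq_sum (X i)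
  -- Multilinearity of `ψ` reduces the target side to Cartan's formula on frame sections. The source
  -- side is brought to the same shape: `hI` treats the anchor terms, `hII` the bracket terms
  -- together with the derivatives of coefficients.
  have hR : ψ (f x₀) W = ∑ a : Fin (k + 1) → Fin n', (∏ i, g i (a i)) *
      A'.differential φ (fun i => Y.sec (a i)) (f x₀) := by
    rw [hWsum, AlternatingMap.map_fun_sum_smul]
    exact Finset.sum_congr rfl fun a _ => by rw [← hψ]
  have hD : ∀ i : Fin (k + 1), derivAlong
      (fun y => φ.pullback F y (fun l => i.removeNth X l y)) (A.anchor x₀ (X i x₀)) =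
      ∑ l, φ (f x₀) (Function.update (i.removeNth W) l
        (Y.flatDeriv F (X (i.succAbove l)) (A.anchor x₀ (X i x₀)))) +
      ∑ a : Fin (k + 1) → Fin n', (∏ i, g i (a i)) * derivAlong
        (fun y => φ y (fun l => i.removeNth (fun j => Y.sec (a j)) l y))
        (A'.anchor (f x₀) (Y.sec (a i) (f x₀))) := by
    intro i
    refine (Y.derivAlong_pullback hf hF hφ (i.removeNth X) _).trans ?_
    refine congrArg₂ (· + ·) rfl ?_
    rw [Y.mfderiv_anchor_eq_sum hanchor, Fin.sum_pi_insertNth i, Finset.sum_comm]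
    refine Finset.sum_congr rfl fun a _ => ?_
    rw [derivAlong_sum_smul, Finset.mul_sum]
    refine Finset.sum_congr rfl fun b _ => ?_
    rw [Fin.prod_univ_succAbove _ i]
    simp only [Fin.insertNth_apply_same, Fin.insertNth_apply_succAbove, Fin.removeNth, hg]
    ring
  change ψ (f x₀) W = _
  rw [hR]
  unfold LieAlgebroid.differential
  simp_rw [hD, mul_add, Finset.sum_add_distrib]
  have hI : ∑ i : Fin (k + 1), (-1 : ℝ) ^ i.val * ∑ a : Fin (k + 1) → Fin n',
      (∏ i, g i (a i)) * derivAlong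
        (fun y => φ y (fun l => i.removeNth (fun j => Y.sec (a j)) l y))
        (A'.anchor (f x₀) (Y.sec (a i) (f x₀))) =
      ∑ a : Fin (k + 1) → Fin n', (∏ i, g i (a i)) * ∑ i : Fin (k + 1), (-1 : ℝ) ^ i.val *
        derivAlong (fun y => φ y (fun l => i.removeNth (fun j => Y.sec (a j)) l y))
          (A'.anchor (f x₀) (Y.sec (a i) (f x₀))) := by
    simp_rw [Finset.mul_sum]
    rw [Finset.sum_comm]
    exact Finset.sum_congr rfl fun a _ => Finset.sum_congr rfl fun i _ => by ring
  have hII : ∑ i : Fin (k + 1), (-1 : ℝ) ^ i.val *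
        ∑ l, φ (f x₀) (Function.update (i.removeNth W) l
          (Y.flatDeriv F (X (i.succAbove l)) (A.anchor x₀ (X i x₀)))) +
      A.bracketTerm k (φ.pullback F) X x₀ =
      ∑ a : Fin (k + 1) → Fin n', (∏ i, g i (a i)) *
        A'.bracketTerm k φ (fun i => Y.sec (a i)) (f x₀) := by
    cases k with
    | zero => simp [LieAlgebroid.bracketTerm]
    | succ k =>
      have hb : ∀ (i : Fin (k + 1)) (j : Fin (k + 2)), φ.pullback F x₀
          (Fin.cons (A.bracket (X i.castSucc) (X j) x₀)
            (fun l => i.removeNth (j.removeNth X) l x₀)) =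
          (φ (f x₀)).curryLeft (∑ p, ∑ q, (g i.castSucc p * g j q) •
            A'.bracket (Y.sec p) (Y.sec q) (f x₀)) (i.removeNth (j.removeNth W)) +
          (φ (f x₀)).curryLeft (Y.flatDeriv F (X j) (A.anchor x₀ (X i.castSucc x₀)) -
            Y.flatDeriv F (X i.castSucc) (A.anchor x₀ (X j x₀))) (i.removeNth (j.removeNth W)) := by
        intro i j
        rw [← AlternatingMap.add_apply, ← map_add,
          ← Y.map_bracket hf hF hanchor (hsep x₀)]
        refine congrArg (φ (f x₀)) (funext fun l => ?_)
        refine Fin.cases ?_ (fun l => ?_) l <;> rfl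
      -- The derivatives of coefficients coming from the anchor terms cancel against those that
      -- `map_bracket` puts into the bracket terms.
      have hz := (φ (f x₀)).sum_update_add_sum_cons_eq_zero W
        (fun i j => Y.flatDeriv F (X j) (A.anchor x₀ (X i x₀)))
      simp only [LieAlgebroid.bracketTerm, hb]
      have hsplit : ∀ (i : Fin (k + 1)) (j : Fin (k + 2)) (s t : ℝ),
          (if i.castSucc < j then (-1 : ℝ) ^ (i.val + j.val) * (s + t) else 0) =
          (if i.castSucc < j then (-1 : ℝ) ^ (i.val + j.val) * s else 0) +
          (if i.castSucc < j then (-1 : ℝ) ^ (i.val + j.val) * t else 0) := by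
        intro i j s t
        split_ifs <;> ring
      simp only [hsplit, Finset.sum_add_distrib]
      rw [add_left_comm, hz, add_zero]
      have hterm : ∀ (j : Fin (k + 2)) (i : Fin (k + 1)), (if i.castSucc < j then
          (-1 : ℝ) ^ (i.val + j.val) * (φ (f x₀)).curryLeft (∑ p, ∑ q, (g i.castSucc p * g j q) •
            A'.bracket (Y.sec p) (Y.sec q) (f x₀)) (i.removeNth (j.removeNth W)) else 0) =
          ∑ a : Fin (k + 2) → Fin n', (∏ l, g l (a l)) * (if i.castSucc < j then
            (-1 : ℝ) ^ (i.val + j.val) *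
              φ (f x₀) (Fin.cons (A'.bracket (Y.sec (a i.castSucc)) (Y.sec (a j)) (f x₀))
                (fun l => i.removeNth (j.removeNth fun l => Y.sec (a l)) l (f x₀))) else 0) := by
        intro j i
        split_ifs with hij
        · rw [hWsum, (φ (f x₀)).curryLeft_sum_sum_smul g _
            (fun p q => A'.bracket (Y.sec p) (Y.sec q) (f x₀)) hij, Finset.mul_sum]
          refine Finset.sum_congr rfl fun a _ => ?_
          rw [mul_left_comm]
          refine congrArg (fun t => _ * (_ * t)) (congrArg (φ (f x₀)) (funext fun l => ?_))
          refine Fin.cases ?_ (fun l => ?_) l <;> rfl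
        · simp
      simp_rw [hterm, Finset.mul_sum]
      refine ((Finset.sum_comm).trans (Finset.sum_congr rfl fun j _ => ?_)).symm
      exact Finset.sum_comm
  rw [hI]
  linarith [hII]

end MorphismCriterion

/-! ### Consequences of being a morphism -/

section MorphismProperties

variable {m n m' n' : ℕ}
  {Q : Type*} [TopologicalSpace Q] [ChartedSpace (EuclideanSpace ℝ (Fin m)) Q]
  {E : Q → Type*} [∀ x, AddCommGroup (E x)] [∀ x, Module ℝ (E x)]
  [∀ x, TopologicalSpace (E x)] [TopologicalSpace (TotalSpace (EuclideanSpace ℝ (Fin n)) E)]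
  [FiberBundle (EuclideanSpace ℝ (Fin n)) E]
  {Q' : Type*} [TopologicalSpace Q'] [ChartedSpace (EuclideanSpace ℝ (Fin m')) Q']
  {E' : Q' → Type*} [∀ x, AddCommGroup (E' x)] [∀ x, Module ℝ (E' x)]
  [∀ x, TopologicalSpace (E' x)] [TopologicalSpace (TotalSpace (EuclideanSpace ℝ (Fin n')) E')]
  [FiberBundle (EuclideanSpace ℝ (Fin n')) E']
  {f : Q → Q'} {F : ∀ x, E x →ₗ[ℝ] E' (f x)}

/-- The `1`-form given by a family of linear forms. -/
def FibreForm.ofDual (θ : ∀ x, E x →ₗ[ℝ] ℝ) : FibreForm E 1 := fun x =>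
  AlternatingMap.ofSubsingleton ℝ (E x) ℝ (0 : Fin 1) (θ x)

theorem FibreForm.isSmooth_ofDual_coord {x₀ : Q} (Z : SectionFrame m n E x₀) (a : Fin n) :
    (FibreForm.ofDual (Z.coord a)).IsSmooth m n := fun X =>
  (Z.contMDiff_coord a).comp (X 0).contMDiff

theorem FibreForm.isSmooth_zero (k : ℕ) : (0 : FibreForm E k).IsSmooth m n := fun _ =>
  contMDiff_const

theorem FibreForm.IsSmooth.pullback [T2Space Q']
    [IsManifold (𝓡 m') ∞ Q'] [VectorBundle ℝ (EuclideanSpace ℝ (Fin n')) E']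
    [ContMDiffVectorBundle ∞ (EuclideanSpace ℝ (Fin n')) E' (𝓡 m')] {k : ℕ} {φ : FibreForm E' k}
    (hφ : φ.IsSmooth m' n') (hf : ContMDiff (𝓡 m) (𝓡 m') ∞ f)
    (hF : ContMDiff ((𝓡 m).prod 𝓘(ℝ, EuclideanSpace ℝ (Fin n)))
      ((𝓡 m').prod 𝓘(ℝ, EuclideanSpace ℝ (Fin n'))) ∞
      (fun p : TotalSpace (EuclideanSpace ℝ (Fin n)) E =>
        (⟨f p.1, F p.1 p.2⟩ : TotalSpace (EuclideanSpace ℝ (Fin n')) E'))) :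
    (φ.pullback F).IsSmooth m n := fun X _ =>
  hφ.contMDiffAt_apply (W := fun l x => F x (X l x)) hf.contMDiffAt
    fun l => (hF.comp (X l).contMDiff).contMDiffAt

variable [IsManifold (𝓡 m) ∞ Q] [VectorBundle ℝ (EuclideanSpace ℝ (Fin n)) E]
  [IsManifold (𝓡 m') ∞ Q'] [VectorBundle ℝ (EuclideanSpace ℝ (Fin n')) E']
  {A : LieAlgebroid m n E} {A' : LieAlgebroid m' n' E'}

/-- A Lie algebroid morphism is compatible with the anchors. -/
theorem IsLieAlgebroidMorphism.mfderiv_anchor [T2Space Q] [T2Space Q']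
    [ContMDiffVectorBundle ∞ (EuclideanSpace ℝ (Fin n)) E (𝓡 m)]
    (h : IsLieAlgebroidMorphism A A' f F) (x : Q) (e : E x) :
    mfderiv (𝓡 m) (𝓡 m') f x (A.anchor x e) = A'.anchor (f x) (F x e) := by
  obtain ⟨X, rfl⟩ := exists_sec_apply_eq (m := m) (n := n) e
  refine eq_of_derivAlong_eq fun g hg => ?_
  have hφ : FibreForm.IsSmooth m' n'
      (fun y => AlternatingMap.constOfIsEmpty ℝ (E' y) (Fin 0) (g y) : FibreForm E' 0) :=
    fun _ => hg
  -- The differential of a function `g`, seen as a 0-form, is `dg ∘ ρ'`; the morphism property in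
  -- degree zero is therefore anchor compatibility tested on `g`.
  set θ : ∀ y, E' y →ₗ[ℝ] ℝ := fun y =>
    (mfderiv (𝓡 m') 𝓘(ℝ, ℝ) g y : TangentSpace (𝓡 m') y →L[ℝ] ℝ).toLinearMap ∘ₗ A'.anchor y
  have hψ : (FibreForm.ofDual θ).IsSmooth m' n' := fun Y =>
    contMDiff_derivAlong hg (A'.contMDiff_anchor_section (Y 0))
  have hd := h.differential 0 _ _ hφ hψ (fun Y y => by
    rw [A'.differential_zero]
    rfl) ![X] x
  rw [A.differential_zero] at hd
  rw [← derivAlong_comp (hg.mdifferentiableAt_real _) (h.contMDiff_base.mdifferentiable (by simp) x)]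
  exact hd.symm

/-- Closedness is the morphism property with zero as the differential. Restriction to a subalgebroid
is pull-back along its inclusion, so this covers the restricted systems. -/
theorem IsPresymplecticSystem.pullback [T2Space Q']
    [ContMDiffVectorBundle ∞ (EuclideanSpace ℝ (Fin n')) E' (𝓡 m')]
    {Ω : FibreForm E' 2} {α : FibreForm E' 1} (h : IsPresymplecticSystem A' Ω α)
    (hF : IsLieAlgebroidMorphism A A' f F) :
    IsPresymplecticSystem A (Ω.pullback F) (α.pullback F) where
  smooth_two := h.smooth_two.pullback hF.contMDiff_base hF.contMDiff_total
  closed_two := hF.differential 2 Ω 0 h.smooth_two (FibreForm.isSmooth_zero 3) h.closed_two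
  smooth_one := h.smooth_one.pullback hF.contMDiff_base hF.contMDiff_total
  closed_one := hF.differential 1 α 0 h.smooth_one (FibreForm.isSmooth_zero 2) h.closed_one

end MorphismProperties

/-! ### Lifting curves along submersions of normed spaces -/

section CurveLifting

variable {V V' : Type*} [NormedAddCommGroup V] [NormedSpace ℝ V] [CompleteSpace V]
  [NormedAddCommGroup V'] [NormedSpace ℝ V']

/-- A local homeomorphism inverse to a smooth map with invertible derivative at a point, smooth at
all points of its target. -/
theorem exists_smooth_local_inverse {Ψ : V → V'} {U : Set V} (hU : IsOpen U)
    (hΨ : ContDiffOn ℝ ∞ Ψ U) {a : V} (ha : a ∈ U) {L : V ≃L[ℝ] V'}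
    (hL : HasFDerivAt Ψ (L : V →L[ℝ] V') a) :
    ∃ (W : Set V') (Φ : V' → V), IsOpen W ∧ Ψ a ∈ W ∧ Φ (Ψ a) = a ∧
      ∀ y ∈ W, Φ y ∈ U ∧ Ψ (Φ y) = y ∧ ContDiffAt ℝ ∞ Φ y := by
  have hΨa : ContDiffAt ℝ ∞ Ψ a := hΨ.contDiffAt (hU.mem_nhds ha)
  set e := hΨa.toOpenPartialHomeomorph Ψ hL (by simp) with he
  have hae : a ∈ e.source := hΨa.mem_toOpenPartialHomeomorph_source hL (by simp)
  have hcoe : (e : V → V') = Ψ := rfl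
  have hsymm : e.symm (Ψ a) = a := e.left_inv hae
  -- The inverse is smooth at images of points where the derivative is invertible; these points form
  -- an open set, to which the local inverse is restricted.
  set S : Set V := U ∩ fderiv ℝ Ψ ⁻¹' range ((↑) : (V ≃L[ℝ] V') → V →L[ℝ] V') with hS
  have hSo : IsOpen S := (hΨ.continuousOn_fderiv_of_isOpen hU (by simp)).isOpen_inter_preimage hU
    ContinuousLinearEquiv.isOpen
  have haS : a ∈ S := ⟨ha, L, hL.fderiv.symm⟩
  refine ⟨e.target ∩ e.symm ⁻¹' S, e.symm, e.isOpen_inter_preimage_symm hSo,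
    ⟨e.map_source hae, ?_⟩, hsymm, ?_⟩
  · change e.symm (Ψ a) ∈ S
    rwa [hsymm]
  · rintro y ⟨hy, hyU, L', hL'⟩
    have hc : ContDiffAt ℝ ∞ Ψ (e.symm y) := hΨ.contDiffAt (hU.mem_nhds hyU)
    refine ⟨hyU, e.right_inv hy, e.contDiffAt_symm (f₀' := L') hy ?_ hc⟩
    rw [hL']
    exact (hc.differentiableAt (by simp)).hasFDerivAt

/-- Smooth curves lift along a submersion, with any prescribed initial velocity. -/
theorem exists_curve_lift {V V' : Type*} [NormedAddCommGroup V] [NormedSpace ℝ V]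
    [FiniteDimensional ℝ V] [NormedAddCommGroup V'] [NormedSpace ℝ V'] [FiniteDimensional ℝ V']
    {g : V → V'} {U : Set V} (hU : IsOpen U) (hg : ContDiffOn ℝ ∞ g U)
    {a : V} (ha : a ∈ U) (hsurj : Function.Surjective (fderiv ℝ g a)) {c' : ℝ → V'}
    (hc' : ∀ᶠ t in 𝓝 (0 : ℝ), ContDiffAt ℝ ∞ c' t) (h0 : c' 0 = g a) {v : V}
    (hv : fderiv ℝ g a v = deriv c' 0) :
    ∃ c : ℝ → V, (∀ᶠ t in 𝓝 (0 : ℝ), ContDiffAt ℝ ∞ c t ∧ c t ∈ U ∧ g (c t) = c' t) ∧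
      c 0 = a ∧ deriv c 0 = v := by
  have : CompleteSpace V := FiniteDimensional.complete ℝ V
  have : CompleteSpace V' := FiniteDimensional.complete ℝ V'
  set D := fderiv ℝ g a with hD
  obtain ⟨R, hR⟩ := D.exists_rightInverse_of_surjective (LinearMap.range_eq_top.2 hsurj)
  have hR' : ∀ w, D (R w) = w := fun w => DFunLike.congr_fun hR w
  have hga : HasFDerivAt g D a :=
    ((hg.contDiffAt (hU.mem_nhds ha)).differentiableAt (by simp)).hasFDerivAt
  -- The line through `a` with velocity `v` is corrected by the section `R` of the derivative. With
  -- time kept as a coordinate, `Ψ` is a local diffeomorphism at the origin, and the lift is `κ`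
  -- applied to the local inverse at `(t, c' t)`.
  set κ : ℝ × V' → V := fun p => a + (p.1 • v + R p.2) with hκ
  have hκs : ContDiff ℝ ∞ κ := by fun_prop
  have hκ0 : κ (0, 0) = a := by simp [hκ]
  set K : ℝ × V' →L[ℝ] V := (ContinuousLinearMap.fst ℝ ℝ V').smulRight v +
    R.comp (ContinuousLinearMap.snd ℝ ℝ V') with hK
  have hκd : HasFDerivAt κ K (0, 0) := (K.hasFDerivAt (x := ((0 : ℝ), (0 : V')))).const_add a
  set Ψ : ℝ × V' → ℝ × V' := fun p => (p.1, g (κ p)) with hΨdef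
  set O : Set (ℝ × V') := κ ⁻¹' U with hO
  have hOo : IsOpen O := hU.preimage hκs.continuous
  have hΨ : ContDiffOn ℝ ∞ Ψ O :=
    contDiff_fst.contDiffOn.prodMk (hg.comp hκs.contDiffOn fun p hp => hp)
  have hO0 : ((0 : ℝ), (0 : V')) ∈ O := by simpa [hO, hκ0] using ha
  set L : (ℝ × V') ≃L[ℝ] (ℝ × V') := ContinuousLinearEquiv.equivOfInverse
    ((ContinuousLinearMap.fst ℝ ℝ V').prod
      ((ContinuousLinearMap.fst ℝ ℝ V').smulRight (D v) + ContinuousLinearMap.snd ℝ ℝ V'))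
    ((ContinuousLinearMap.fst ℝ ℝ V').prod
      (ContinuousLinearMap.snd ℝ ℝ V' - (ContinuousLinearMap.fst ℝ ℝ V').smulRight (D v)))
    (fun p => by ext <;> simp) (fun p => by ext <;> simp) with hL
  have hΨd : HasFDerivAt Ψ (L : ℝ × V' →L[ℝ] ℝ × V') (0, 0) := by
    have h1 : HasFDerivAt (fun p => g (κ p)) (D.comp K) ((0 : ℝ), (0 : V')) :=
      HasFDerivAt.comp _ (by rwa [hκ0]) hκd
    refine (hasFDerivAt_fst.prodMk h1).congr_fderiv ?_
    ext <;> simp [hL, hK, hR']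
  obtain ⟨W, Φ, hW, hW0, hΦ0, hΦ⟩ := exists_smooth_local_inverse hOo hΨ hO0 hΨd
  have hΨ0 : Ψ (0, 0) = (0, c' 0) := by simp [hΨdef, hκ0, h0]
  rw [hΨ0] at hW0 hΦ0
  set γ : ℝ → ℝ × V' := fun t => (t, c' t) with hγ
  have hγs : ∀ᶠ t in 𝓝 (0 : ℝ), ContDiffAt ℝ ∞ γ t := hc'.mono fun t ht =>
    contDiffAt_id.prodMk ht
  have hγW : ∀ᶠ t in 𝓝 (0 : ℝ), γ t ∈ W :=
    hγs.self_of_nhds.continuousAt.eventually (hW.mem_nhds hW0)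
  refine ⟨fun t => κ (Φ (γ t)), ?_, ?_, ?_⟩
  · filter_upwards [hγs, hγW] with t ht htW
    obtain ⟨h1, h2, h3⟩ := hΦ _ htW
    exact ⟨hκs.contDiffAt.comp t (h3.comp t ht), h1, congrArg Prod.snd h2⟩
  · change κ (Φ (0, c' 0)) = a
    rw [hΦ0, hκ0]
  · obtain ⟨-, -, h3⟩ := hΦ _ hW0
    have hΦd : HasFDerivAt Φ (fderiv ℝ Φ (0, c' 0)) (0, c' 0) :=
      (h3.differentiableAt (by simp)).hasFDerivAt
    have hcomp : (L : ℝ × V' →L[ℝ] ℝ × V').comp (fderiv ℝ Φ (0, c' 0)) =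
        ContinuousLinearMap.id ℝ _ := by
      have h1 : HasFDerivAt (fun y => Ψ (Φ y))
          ((L : ℝ × V' →L[ℝ] ℝ × V').comp (fderiv ℝ Φ (0, c' 0))) (0, c' 0) :=
        HasFDerivAt.comp _ (by rwa [hΦ0]) hΦd
      refine h1.unique ((hasFDerivAt_id _).congr_of_eventuallyEq ?_)
      filter_upwards [hW.mem_nhds hW0] with y hy using (hΦ y hy).2.1
    have hγd : HasDerivAt γ (1, deriv c' 0) 0 := (hasDerivAt_id _).prodMk
      (hc'.self_of_nhds.differentiableAt (by simp)).hasDerivAt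
    -- Since `D v` is the velocity of `c'`, the correction along `R` vanishes to first order, so the
    -- lift has velocity exactly `v`.
    have hz : fderiv ℝ Φ (0, c' 0) (1, deriv c' 0) = (1, 0) := by
      apply L.injective
      have := DFunLike.congr_fun hcomp (1, deriv c' 0)
      refine this.trans ?_
      simp [hL, ← hv]
    have h4 : HasDerivAt (fun t => Φ (γ t)) (1, 0) 0 := by
      rw [← hz]
      exact hΦd.comp_hasDerivAt (0 : ℝ) hγd
    have hκ' : HasFDerivAt κ K (Φ (γ 0)) := by
      change HasFDerivAt κ K (Φ (0, c' 0))
      rwa [hΦ0]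
    have h5 : HasDerivAt (fun t => κ (Φ (γ t))) (K (1, 0)) 0 := 
      HasFDerivAt.comp_hasDerivAt (f := fun t => Φ (γ t)) (0 : ℝ) hκ' h4
    rw [h5.deriv]
    simp [hK]

end CurveLifting

/-! ### Tangent spaces of subsets via curves -/

section TangentTo

variable {m m' : ℕ} {Q : Type*} [TopologicalSpace Q] [ChartedSpace (EuclideanSpace ℝ (Fin m)) Q]
  {Q' : Type*} [TopologicalSpace Q'] [ChartedSpace (EuclideanSpace ℝ (Fin m')) Q']

/-- The velocity of a curve at time `0` in the preferred chart at `c 0`. -/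
theorem mfderiv_curve_eq_deriv {c : ℝ → Q} (hc : MDifferentiableAt 𝓘(ℝ, ℝ) (𝓡 m) c 0) :
    mfderiv 𝓘(ℝ, ℝ) (𝓡 m) c 0 (1 : ℝ) = deriv (fun t => extChartAt (𝓡 m) (c 0) (c t)) 0 := by
  refine (DFunLike.congr_fun hc.mfderiv (1 : ℝ)).trans ?_
  simp only [writtenInExtChartAt, extChartAt_model_space_eq_id, PartialEquiv.refl_symm,
    PartialEquiv.refl_coe, Function.comp_def, id_eq, modelWithCornersSelf_coe, range_id,
    fderivWithin_univ]
  rfl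

theorem mfderiv_eq_fderiv_extChartAt {f : Q → Q'} {x : Q} (hf : MDifferentiableAt (𝓡 m) (𝓡 m') f x) :
    mfderiv (𝓡 m) (𝓡 m') f x =
      fderiv ℝ (fun z => extChartAt (𝓡 m') (f x) (f ((extChartAt (𝓡 m) x).symm z)))
        (extChartAt (𝓡 m) x x) := by
  refine hf.mfderiv.trans ?_
  simp only [modelWithCornersSelf_coe, range_id, fderivWithin_univ, writtenInExtChartAt, Function.comp_def]
  rfl

theorem eventually_mem_iff_exists_Ioo {p : ℝ → Prop} :
    (∀ᶠ t in 𝓝 (0 : ℝ), p t) ↔ ∃ ε > 0, ∀ t ∈ Ioo (-ε) ε, p t := by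
  rw [Metric.eventually_nhds_iff_ball]
  simp [Real.ball_eq_Ioo]

theorem tangentTo_le_comap {f : Q → Q'} (hf : ContMDiff (𝓡 m) (𝓡 m') ∞ f) {S : Set Q}
    {S' : Set Q'} (h : MapsTo f S S') (x : Q) :
    tangentTo m S x ≤
      (tangentTo m' S' (f x)).comap (mfderiv (𝓡 m) (𝓡 m') f x).toLinearMap := by
  refine Submodule.span_le.2 ?_
  rintro v ⟨c, ε, hε, hc, hS, hv⟩
  refine Submodule.subset_span ⟨fun t => f (c t), ε, hε, hf.comp_contMDiffOn hc,
    fun t ht => h (hS t ht), ?_⟩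
  have hcd : MDifferentiableAt 𝓘(ℝ, ℝ) (𝓡 m) c 0 :=
    (hc.contMDiffAt (isOpen_Ioo.mem_nhds (by simp [hε]))).mdifferentiableAt (by simp)
  have := congrArg (tangentMap (𝓡 m) (𝓡 m') f) hv
  refine Eq.trans ?_ this
  refine congrArg (TotalSpace.mk (f (c 0))) ?_
  exact mfderiv_comp_apply (0 : ℝ) (hf.mdifferentiable (by simp) _) hcd 1

/-- In suitable charts an immersion is `y ↦ (y, 0)` up to a linear isomorphism; projecting to the
first factor gives a differentiable local left inverse, and the chain rule applies. -/
theorem mfderiv_injective_of_isImmersionAt {f : Q → Q'} {x : Q}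
    (hf : Manifold.IsImmersionAt (𝓡 m) (𝓡 m') ∞ f x) :
    Function.Injective (mfderiv (𝓡 m) (𝓡 m') f x) := by
  set φ := hf.domChart.extend (𝓡 m) with hφ
  set φ' := hf.codChart.extend (𝓡 m') with hφ'
  set L : Q' → Q := fun y => φ.symm (hf.equiv.symm (φ' y)).1 with hL
  have hchart : ∀ y ∈ hf.domChart.source, φ' (f y) = hf.equiv (φ y, 0) := by
    intro y hy
    have hy' : y ∈ φ.source := by rwa [hφ, OpenPartialHomeomorph.extend_source]
    have := hf.writtenInCharts (φ.map_source hy')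
    simp only [Function.comp_apply] at this
    rwa [← hφ, ← hφ', φ.left_inv hy'] at this
  have hLf : ∀ y ∈ hf.domChart.source, L (f y) = y := by
    intro y hy
    have hy' : y ∈ φ.source := by rwa [hφ, OpenPartialHomeomorph.extend_source]
    simp only [hL, hchart y hy, ContinuousLinearEquiv.symm_apply_apply]
    exact φ.left_inv hy'
  have hx := hf.mem_domChart_source
  have h1 : ContMDiffAt (𝓡 m') 𝓘(ℝ, EuclideanSpace ℝ (Fin m')) ∞ φ' (f x) :=
    hf.codChart.contMDiffAt_extend hf.codChart_mem_maximalAtlas hf.mem_codChart_source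
  have h2 : ContMDiffAt 𝓘(ℝ, EuclideanSpace ℝ (Fin m)) (𝓡 m) ∞ φ.symm (φ x) :=
    (contMDiffOn_extend_symm hf.domChart_mem_maximalAtlas).contMDiffAt (by
      rw [← OpenPartialHomeomorph.extend_target']
      exact (hf.domChart.isOpen_extend_target).mem_nhds (φ.map_source
        (by rwa [hφ, OpenPartialHomeomorph.extend_source])))
  have h3 : MDifferentiableAt 𝓘(ℝ, EuclideanSpace ℝ (Fin m')) 𝓘(ℝ, EuclideanSpace ℝ (Fin m))
      (fun z => (hf.equiv.symm z).1) (φ' (f x)) := by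
    refine DifferentiableAt.mdifferentiableAt ?_
    fun_prop
  have hLd : MDifferentiableAt (𝓡 m') (𝓡 m) L (f x) := by
    refine MDifferentiableAt.comp (I' := 𝓘(ℝ, EuclideanSpace ℝ (Fin m))) (f x) (g := φ.symm) ?_
      (MDifferentiableAt.comp (g := fun z => (hf.equiv.symm z).1) (f x) h3 (h1.mdifferentiableAt (by simp)))
    rw [hchart x hx]
    simpa using h2.mdifferentiableAt (by simp)
  have hcomp : (mfderiv (𝓡 m') (𝓡 m) L (f x)).comp (mfderiv (𝓡 m) (𝓡 m') f x) =
      ContinuousLinearMap.id ℝ (EuclideanSpace ℝ (Fin m)) := by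
    refine (mfderiv_comp x hLd (hf.contMDiffAt.mdifferentiableAt (by simp))).symm.trans ?_
    have hid : L ∘ f =ᶠ[𝓝 x] id := by
      filter_upwards [hf.domChart.open_source.mem_nhds hx] with y hy using hLf y hy
    rw [hid.mfderiv_eq]
    exact mfderiv_id
  intro u v huv
  have := congrArg (mfderiv (𝓡 m') (𝓡 m) L (f x)) huv
  exact ((DFunLike.congr_fun hcomp u).symm.trans this).trans (DFunLike.congr_fun hcomp v)

variable [IsManifold (𝓡 m) ∞ Q] [IsManifold (𝓡 m') ∞ Q']

/-- The curves in the definition of `tangentTo`, expressed in a chart. -/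
theorem mem_tangentTo_of_chart_curve {S : Set Q} {x : Q} {c : ℝ → EuclideanSpace ℝ (Fin m)}
    (h0 : c 0 = extChartAt (𝓡 m) x x)
    (h : ∀ᶠ t in 𝓝 (0 : ℝ), ContDiffAt ℝ ∞ c t ∧ c t ∈ (extChartAt (𝓡 m) x).target ∧
      (extChartAt (𝓡 m) x).symm (c t) ∈ S) :
    (deriv c 0 : TangentSpace (𝓡 m) x) ∈ tangentTo m S x := by
  refine Submodule.subset_span ?_
  obtain ⟨ε, hε, hc⟩ := eventually_mem_iff_exists_Ioo.1 h
  set C : ℝ → Q := fun t => (extChartAt (𝓡 m) x).symm (c t) with hC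
  have hC0 : C 0 = x := by rw [hC]; simp [h0]
  have hCs : ∀ t ∈ Ioo (-ε) ε, ContMDiffAt 𝓘(ℝ, ℝ) (𝓡 m) ∞ C t := fun t ht =>
    ((contMDiffOn_extChartAt_symm x).contMDiffAt
      ((isOpen_extChartAt_target x).mem_nhds (hc t ht).2.1)).comp t (hc t ht).1.contMDiffAt
  refine ⟨C, ε, hε, fun t ht => (hCs t ht).contMDiffWithinAt, fun t ht => (hc t ht).2.2, ?_⟩
  have h0ε : (0 : ℝ) ∈ Ioo (-ε) ε := by simp [hε]
  rw [mfderiv_curve_eq_deriv ((hCs 0 h0ε).mdifferentiableAt (by simp)), hC0]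
  have hev : (fun t => extChartAt (𝓡 m) x (C t)) =ᶠ[𝓝 0] c := by
    filter_upwards [h] with t ht using (extChartAt (𝓡 m) x).right_inv ht.2.1
  rw [hev.deriv_eq]
  rfl

theorem exists_chart_curve {S : Set Q} {x : Q} {c : ℝ → Q} {ε : ℝ} {v : TangentSpace (𝓡 m) x}
    (hε : 0 < ε) (hc : ContMDiffOn 𝓘(ℝ, ℝ) (𝓡 m) ∞ c (Ioo (-ε) ε)) (hS : ∀ t ∈ Ioo (-ε) ε, c t ∈ S)
    (hv : (⟨c 0, mfderiv 𝓘(ℝ, ℝ) (𝓡 m) c 0 (1 : ℝ)⟩ : TangentBundle (𝓡 m) Q) = ⟨x, v⟩) :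
    c 0 = x ∧ (∀ᶠ t in 𝓝 (0 : ℝ), ContMDiffAt 𝓘(ℝ, ℝ) (𝓡 m) ∞ c t ∧ c t ∈ S ∧
      ContDiffAt ℝ ∞ (fun t => extChartAt (𝓡 m) x (c t)) t ∧ c t ∈ (extChartAt (𝓡 m) x).source) ∧
      deriv (fun t => extChartAt (𝓡 m) x (c t)) 0 = v := by
  have hc' : ∀ t ∈ Ioo (-ε) ε, ContMDiffAt 𝓘(ℝ, ℝ) (𝓡 m) ∞ c t := fun t ht =>
    hc.contMDiffAt (isOpen_Ioo.mem_nhds ht)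
  have h0ε : (0 : ℝ) ∈ Ioo (-ε) ε := by simp [hε]
  have h0 : c 0 = x := congrArg TotalSpace.proj hv
  subst h0
  refine ⟨rfl, ?_, ?_⟩
  · filter_upwards [isOpen_Ioo.mem_nhds h0ε, (hc' 0 h0ε).continuousAt.eventually
      (extChartAt_source_mem_nhds (I := 𝓡 m) (c 0))] with t ht ht'
    refine ⟨hc' t ht, hS t ht, ContMDiffAt.contDiffAt ?_, ht'⟩
    exact (contMDiffAt_extChartAt' (by rwa [← extChartAt_source (𝓡 m)])).comp t (hc' t ht)
  · rw [← mfderiv_curve_eq_deriv ((hc' 0 h0ε).mdifferentiableAt (by simp))]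
    exact eq_of_heq (TotalSpace.mk.inj hv).2

theorem tangentTo_univ (x : Q) : tangentTo m univ x = ⊤ := by
  refine eq_top_iff.2 fun v _ => ?_
  obtain ⟨w, rfl⟩ : ∃ w : EuclideanSpace ℝ (Fin m), w = v := ⟨v, rfl⟩
  -- A straight line in the chart realizes any given velocity.
  set c : ℝ → EuclideanSpace ℝ (Fin m) := fun t => extChartAt (𝓡 m) x x + t • w with hc
  have hcs : ContDiff ℝ ∞ c := by
    have : ContDiff ℝ ∞ fun t : ℝ => t • w :=
      contDiff_id.smul contDiff_const
    exact contDiff_const.add this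
  have h0 : c 0 = extChartAt (𝓡 m) x x := by simp [hc]
  have hd : deriv c 0 = w := by
    have : HasDerivAt c ((1 : ℝ) • w) 0 :=
      ((hasDerivAt_id (0 : ℝ)).smul_const _).const_add _
    rw [this.deriv]
    exact one_smul ℝ w
  refine (congrArg (· ∈ tangentTo m univ x) hd).mp ?_
  refine mem_tangentTo_of_chart_curve h0 ?_
  filter_upwards [hcs.continuous.continuousAt.eventually
    (show (extChartAt (𝓡 m) x).target ∈ 𝓝 (c 0) by rw [h0]; exact extChartAt_target_mem_nhds x)]
    with t ht using ⟨hcs.contDiffAt, ht, mem_univ _⟩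

/-- The tangent space of an embedded submanifold is the image of the derivative of the inclusion. -/
theorem tangentTo_eq_range {S : Set Q} {d : ℕ} [ChartedSpace (EuclideanSpace ℝ (Fin d)) S]
    [IsManifold (𝓡 d) ∞ S]
    (hS : Manifold.IsSmoothEmbedding (𝓡 d) (𝓡 m) ∞ (Subtype.val : S → Q)) (x : S) :
    tangentTo m S (x : Q) =
      LinearMap.range (mfderiv (𝓡 d) (𝓡 m) (Subtype.val : S → Q) x).toLinearMap := by
  have hι : ContMDiff (𝓡 d) (𝓡 m) ∞ (Subtype.val : S → Q) := hS.contMDiff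
  refine le_antisymm (Submodule.span_le.2 ?_) ?_
  · rintro v ⟨c, ε, hε, hc, hcS, hv⟩
    obtain ⟨h0, hev, hcv⟩ := exists_chart_curve hε hc hcS hv
    classical
    -- The curve is only known to lie in `S` near time 0, and takes a dummy value elsewhere. As a
    -- map into `S` it is continuous at 0 for the induced topology, hence smooth there because the
    -- inclusion is an immersion.
    set c' : ℝ → S := fun t => if h : c t ∈ S then ⟨c t, h⟩ else x with hc'
    have hval : (Subtype.val ∘ c') =ᶠ[𝓝 0] c := by
      filter_upwards [hev] with t ht
      simp [hc', ht.2.1]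
    have hc0 : c' 0 = x := Subtype.ext (by rw [← h0]; exact hval.self_of_nhds)
    have hsm : ContMDiffAt 𝓘(ℝ, ℝ) (𝓡 m) ∞ (Subtype.val ∘ c') 0 :=
      hev.self_of_nhds.1.congr_of_eventuallyEq hval
    have hcs : ContMDiffAt 𝓘(ℝ, ℝ) (𝓡 d) ∞ c' 0 := by
      refine (ContMDiffAt.iff_comp_isImmersionAt (hS.isImmersion.isImmersionAt (c' 0))).2
        ⟨hS.isEmbedding.isInducing.continuousAt_iff.2 hsm.continuousAt, hsm⟩
    have hd := mfderiv_comp_apply (0 : ℝ) (hι.mdifferentiable (by simp) (c' 0))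
      (hcs.mdifferentiableAt (by simp)) (1 : ℝ)
    have hd' : (mfderiv 𝓘(ℝ, ℝ) (𝓡 m) (Subtype.val ∘ c') 0 (1 : ℝ) : EuclideanSpace ℝ (Fin m)) = v := by
      refine (mfderiv_curve_eq_deriv (hsm.mdifferentiableAt (by simp))).trans (Eq.trans ?_ hcv)
      rw [show (Subtype.val ∘ c') 0 = (x : Q) from congrArg Subtype.val hc0]
      exact (hval.fun_comp (extChartAt (𝓡 m) (x : Q))).deriv_eq
    have key : ∀ (y : S) (u : TangentSpace (𝓡 d) y), y = x →
        (mfderiv (𝓡 d) (𝓡 m) (Subtype.val : S → Q) y u : EuclideanSpace ℝ (Fin m)) = v →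
        v ∈ LinearMap.range (mfderiv (𝓡 d) (𝓡 m) (Subtype.val : S → Q) x).toLinearMap := by
      rintro y u rfl hu
      exact ⟨u, hu⟩
    exact key _ _ hc0 (hd.symm.trans hd')
  · rintro _ ⟨u, rfl⟩
    refine tangentTo_le_comap hι (S := univ) (fun y _ => y.2) x ?_
    rw [tangentTo_univ]
    trivial

/-- The tangent spaces of the preimage of a subset under a submersion. -/
theorem tangentTo_preimage {f : Q → Q'} (hf : ContMDiff (𝓡 m) (𝓡 m') ∞ f) {x : Q}
    (hsurj : Function.Surjective (mfderiv (𝓡 m) (𝓡 m') f x)) {S' : Set Q'} (hx : f x ∈ S') :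
    tangentTo m (f ⁻¹' S') x =
      (tangentTo m' S' (f x)).comap (mfderiv (𝓡 m) (𝓡 m') f x).toLinearMap := by
  refine le_antisymm (tangentTo_le_comap hf (mapsTo_preimage _ _) x) ?_
  set φ := extChartAt (𝓡 m) x with hφ
  set φ' := extChartAt (𝓡 m') (f x) with hφ'
  set U : Set (EuclideanSpace ℝ (Fin m)) := φ.target ∩ φ.symm ⁻¹' (f ⁻¹' φ'.source) with hU
  have hUo : IsOpen U := (contMDiffOn_extChartAt_symm (n := ∞) x).continuousOn.isOpen_inter_preimage
    (isOpen_extChartAt_target x) ((isOpen_extChartAt_source (f x)).preimage hf.continuous)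
  set g : EuclideanSpace ℝ (Fin m) → EuclideanSpace ℝ (Fin m') := fun z => φ' (f (φ.symm z)) with hg
  have hgs : ContDiffOn ℝ ∞ g U := by
    refine ContMDiffOn.contDiffOn ?_
    exact (contMDiffOn_extChartAt (x := f x)).comp
      (hf.comp_contMDiffOn ((contMDiffOn_extChartAt_symm x).mono inter_subset_left))
      fun z hz => by
        rw [← extChartAt_source (𝓡 m')]
        exact hz.2
  have hxx : φ.symm (φ x) = x := extChartAt_to_inv x
  have haU : φ x ∈ U := ⟨mem_extChartAt_target x, by
    change f (φ.symm (φ x)) ∈ φ'.source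
    rw [hxx]
    exact mem_extChartAt_source (f x)⟩
  have hmf := mfderiv_eq_fderiv_extChartAt (hf.mdifferentiable (by simp) x)
  -- A vector over the velocity of a curve in `S'` is the velocity of a lifted curve, which
  -- automatically stays in the preimage of `S'`.
  have hlift : ∀ (c' : ℝ → Q') (v : TangentSpace (𝓡 m) x), c' 0 = f x →
      (∀ᶠ t in 𝓝 (0 : ℝ), c' t ∈ S' ∧ ContDiffAt ℝ ∞ (fun t => φ' (c' t)) t ∧ c' t ∈ φ'.source) →
      deriv (fun t => φ' (c' t)) 0 = mfderiv (𝓡 m) (𝓡 m') f x v → v ∈ tangentTo m (f ⁻¹' S') x := by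
    intro c' v h0 hev hv
    obtain ⟨c, hc, hc0, hcv⟩ := exists_curve_lift (c' := fun t => φ' (c' t)) (v := v) hUo hgs haU
      (by rw [← hmf]; exact hsurj) (hev.mono fun t ht => ht.2.1)
      (by simp only [hg, hxx, h0]) (by rw [← hmf]; exact hv.symm)
    rw [← hcv]
    refine mem_tangentTo_of_chart_curve hc0 ?_
    filter_upwards [hc, hev] with t ht ht'
    refine ⟨ht.1, ht.2.1.1, ?_⟩
    have : f (φ.symm (c t)) = c' t := φ'.injOn ht.2.1.2 ht'.2.2 ht.2.2
    change f (φ.symm (c t)) ∈ S'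
    rw [this]
    exact ht'.1
  -- Vertical vectors are velocities of lifts of the constant curve.
  have hker : ∀ v, mfderiv (𝓡 m) (𝓡 m') f x v = 0 → v ∈ tangentTo m (f ⁻¹' S') x := by
    intro v hv
    refine hlift (fun _ => f x) v rfl (.of_forall fun _ =>
      ⟨hx, contDiffAt_const, mem_extChartAt_source _⟩) ?_
    rw [hv, deriv_const]
    rfl
  intro v hv
  -- Induction over the span downstairs, with the claim made for all lifts `v` at once: sums and
  -- multiples are lifted separately, and the discrepancy with `v` is absorbed by a lift of another
  -- vector or by `hker`.
  suffices h : ∀ v' ∈ tangentTo m' S' (f x), ∀ v, mfderiv (𝓡 m) (𝓡 m') f x v = v' →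
      v ∈ tangentTo m (f ⁻¹' S') x from h _ hv v rfl
  intro v' hv'
  refine Submodule.span_induction ?_ hker ?_ ?_ hv'
  · rintro w ⟨c, ε, hε, hc, hcS, hw⟩ v hv
    obtain ⟨h0, hev, hd⟩ := exists_chart_curve hε hc hcS hw
    exact hlift c v h0 (hev.mono fun t ht => ht.2) (hd.trans hv.symm)
  · intro a b _ _ ha hb v hv
    obtain ⟨u, hu⟩ := hsurj a
    have := Submodule.add_mem _ (ha u hu) (hb (v - u) (by rw [map_sub, hu, hv, add_sub_cancel_left]))
    rwa [add_sub_cancel] at this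
  · intro r a _ ha v hv
    obtain ⟨u, hu⟩ := hsurj a
    have := Submodule.add_mem _ (Submodule.smul_mem _ r (ha u hu))
      (hker (v - r • u) (by rw [map_sub, map_smul, hu, hv, sub_self]))
    rwa [add_sub_cancel] at this

end TangentTo

/-- Both sides evaluate `φ` on images under `F`. This moves identities for forms on the ambient
bundles to the subbundles. -/
theorem FibreForm.pullback_restrict {Q Q' : Type*} {E : Q → Type*} {E' : Q' → Type*}
    [∀ x, AddCommGroup (E x)] [∀ x, Module ℝ (E x)] [∀ x, AddCommGroup (E' x)]
    [∀ x, Module ℝ (E' x)] {f : Q → Q'} {F : ∀ x, E x →ₗ[ℝ] E' (f x)} {k : ℕ} (φ : FibreForm E' k)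
    {S : Set Q} {S' : Set Q'} (hf : MapsTo f S S') {K : ∀ x, Submodule ℝ (E x)}
    {K' : ∀ y, Submodule ℝ (E' y)} (hK : ∀ x ∈ S, ∀ e ∈ K x, F x e ∈ K' (f x)) :
    (φ.restrict S' K').pullback (f := hf.restrict f S S') (fun x => (F x).restrict (hK x x.2)) =
      (φ.pullback F).restrict S K :=
  rfl

/-! ### Dynamical epimorphisms and the constraint algorithm -/

section DynamicalEpimorphisms

variable {m n m' n' : ℕ}
  {Q : Type*} [TopologicalSpace Q] [ChartedSpace (EuclideanSpace ℝ (Fin m)) Q]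
  [IsManifold (𝓡 m) ∞ Q]
  {E : Q → Type*} [∀ x, AddCommGroup (E x)] [∀ x, Module ℝ (E x)]
  [∀ x, TopologicalSpace (E x)] [TopologicalSpace (TotalSpace (EuclideanSpace ℝ (Fin n)) E)]
  [FiberBundle (EuclideanSpace ℝ (Fin n)) E] [VectorBundle ℝ (EuclideanSpace ℝ (Fin n)) E]
  {Q' : Type*} [TopologicalSpace Q'] [ChartedSpace (EuclideanSpace ℝ (Fin m')) Q']
  [IsManifold (𝓡 m') ∞ Q']
  {E' : Q' → Type*} [∀ x, AddCommGroup (E' x)] [∀ x, Module ℝ (E' x)]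
  [∀ x, TopologicalSpace (E' x)] [TopologicalSpace (TotalSpace (EuclideanSpace ℝ (Fin n')) E')]
  [FiberBundle (EuclideanSpace ℝ (Fin n')) E'] [VectorBundle ℝ (EuclideanSpace ℝ (Fin n')) E']
  {A : LieAlgebroid m n E} {Ω : FibreForm E 2} {α : FibreForm E 1}
  {A' : LieAlgebroid m' n' E'} {Ω' : FibreForm E' 2} {α' : FibreForm E' 1}
  {π : Q → Q'} {P : ∀ x, E x →ₗ[ℝ] E' (π x)}

namespace IsDynamicalEpimorphism

theorem two_apply (hP : IsDynamicalEpimorphism A Ω α A' Ω' α' π P) (x : Q) (e f : E x) :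
    Ω x ![e, f] = Ω' (π x) ![P x e, P x f] := by
  rw [← hP.pullback_two]
  exact congrArg (Ω' (π x)) (by ext i; fin_cases i <;> rfl)

theorem one_apply (hP : IsDynamicalEpimorphism A Ω α A' Ω' α' π P) (x : Q) (e : E x) :
    α x ![e] = α' (π x) ![P x e] := by
  rw [← hP.pullback_one]
  exact congrArg (α' (π x)) (by ext i; fin_cases i; rfl)

/-- The equation at `x` tested on `e` is the equation at `π x` tested on `P x e`. Every point of
`S'` is reached from `S`, a full preimage, and every test vector from its fibre. -/
theorem solvesAlong_iff (hP : IsDynamicalEpimorphism A Ω α A' Ω' α' π P) {S : Set Q} {S' : Set Q'}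
    (hS : S = π ⁻¹' S') {K : ∀ x, Submodule ℝ (E x)} {K' : ∀ y, Submodule ℝ (E' y)}
    (hπ : MapsTo π S S') {X : ∀ x : S, K x} {X' : ∀ y : S', K' y}
    (hX : ∀ x : S, (X' ⟨π x, hπ x.2⟩ : E' (π x)) = P x (X x)) :
    SolvesAlong Ω α X ↔ SolvesAlong Ω' α' X' := by
  constructor
  · rintro h ⟨y, hy⟩ e'
    obtain ⟨x, rfl⟩ := hP.surjective y
    obtain ⟨e, rfl⟩ := hP.fibre_surjective x e'
    have hx : x ∈ S := by rwa [hS]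
    have := h ⟨x, hx⟩ e
    rw [hP.two_apply, hP.one_apply, ← hX ⟨x, hx⟩] at this
    exact this
  · intro h x e
    rw [hP.two_apply, hP.one_apply, ← hX x]
    exact h ⟨π x, hπ x.2⟩ (P x e)

variable [T2Space Q] [T2Space Q'] [ContMDiffVectorBundle ∞ (EuclideanSpace ℝ (Fin n)) E (𝓡 m)]

theorem anchorPreimage_preimage (hP : IsDynamicalEpimorphism A Ω α A' Ω' α' π P) {S' : Set Q'}
    {x : Q} (hx : π x ∈ S') :
    A.anchorPreimage (π ⁻¹' S') x = (A'.anchorPreimage S' (π x)).comap (P x) := by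
  ext e
  change A.anchor x e ∈ tangentTo m (π ⁻¹' S') x ↔ A'.anchor (π x) (P x e) ∈ tangentTo m' S' (π x)
  rw [tangentTo_preimage hP.morphism.contMDiff_base (hP.submersion x) hx,
    ← hP.morphism.mfderiv_anchor]
  rfl

theorem constraintSet_eq_preimage (hP : IsDynamicalEpimorphism A Ω α A' Ω' α' π P) (k : ℕ) :
    A.constraintSet Ω α k = π ⁻¹' A'.constraintSet Ω' α' k := by
  induction k with
  | zero => rfl
  | succ k ih =>
    ext x
    simp only [LieAlgebroid.constraintSet, ih, mem_preimage, mem_ofPred_eq]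
    refine and_congr_right fun hx => ?_
    rw [hP.anchorPreimage_preimage hx]
    -- Fibre surjectivity turns quantifiers over the fibre at `π x` into quantifiers over the fibre
    -- at `x`, both for `e` and for the vectors it is orthogonal to.
    simp only [(hP.fibre_surjective x).forall, hP.two_apply, hP.one_apply, Submodule.mem_comap]

theorem constraintFibre_eq_comap (hP : IsDynamicalEpimorphism A Ω α A' Ω' α' π P) {k : ℕ} {x : Q}
    (hx : x ∈ A.constraintSet Ω α k) :
    A.constraintFibre Ω α k x = (A'.constraintFibre Ω' α' k (π x)).comap (P x) := by
  rw [hP.constraintSet_eq_preimage] at hx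
  rw [LieAlgebroid.constraintFibre, hP.constraintSet_eq_preimage,
    hP.anchorPreimage_preimage (S' := A'.constraintSet Ω' α' k) hx]
  rfl

theorem image_constraintTotal (hP : IsDynamicalEpimorphism A Ω α A' Ω' α' π P) (k : ℕ) :
    (fun p : TotalSpace (EuclideanSpace ℝ (Fin n)) E =>
      (⟨π p.1, P p.1 p.2⟩ : TotalSpace (EuclideanSpace ℝ (Fin n')) E')) ''
        A.constraintTotal Ω α k = A'.constraintTotal Ω' α' k := by
  have h : A.constraintTotal Ω α k = (fun p : TotalSpace (EuclideanSpace ℝ (Fin n)) E =>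
      (⟨π p.1, P p.1 p.2⟩ : TotalSpace (EuclideanSpace ℝ (Fin n')) E')) ⁻¹'
        A'.constraintTotal Ω' α' k := by
    ext ⟨x, e⟩
    have h1 : x ∈ A.constraintSet Ω α k ↔ π x ∈ A'.constraintSet Ω' α' k := by
      rw [hP.constraintSet_eq_preimage]
      rfl
    refine (and_congr_right fun hx => ?_).trans (and_congr_left' h1)
    change e ∈ A.constraintFibre Ω α k x ↔ _
    rw [hP.constraintFibre_eq_comap hx]
    rfl
  rw [h]
  refine image_preimage_eq _ ?_
  rintro ⟨y, e'⟩
  obtain ⟨x, rfl⟩ := hP.surjective y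
  obtain ⟨e, rfl⟩ := hP.fibre_surjective x e'
  exact ⟨⟨x, e⟩, rfl⟩

variable [ContMDiffVectorBundle ∞ (EuclideanSpace ℝ (Fin n')) E' (𝓡 m')]

/-- A dynamical epimorphism restricts to Lie subalgebroids which are preimages of each other. -/
theorem restrict (hP : IsDynamicalEpimorphism A Ω α A' Ω' α' π P) {S : Set Q} {S' : Set Q'}
    (hS : S = π ⁻¹' S') {K : ∀ x, Submodule ℝ (E x)} {K' : ∀ y, Submodule ℝ (E' y)}
    (hKK' : ∀ x ∈ S, K x = (K' (π x)).comap (P x))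
    (R : LieSubalgebroid A S K) (R' : LieSubalgebroid A' S' K') (hπ : MapsTo π S S')
    (hK : ∀ x ∈ S, ∀ e ∈ K x, P x e ∈ K' (π x)) :
    IsDynamicalEpimorphism R.algebroid (Ω.restrict S K) (α.restrict S K)
      R'.algebroid (Ω'.restrict S' K') (α'.restrict S' K')
      (hπ.restrict π S S') (fun x => (P x).restrict (hK x x.2)) := by
  set f : S → S' := hπ.restrict π S S' with hf
  have hι := R.inclusion.contMDiff_base
  have hι' := R'.inclusion.contMDiff_base
  have hinj : ∀ y : S', Function.Injective
      (mfderiv (𝓡 R'.dim) (𝓡 m') (Subtype.val : S' → Q') y) := fun y =>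
    mfderiv_injective_of_isImmersionAt (R'.isSmoothEmbedding.isImmersion.isImmersionAt y)
  have hfs : ContMDiff (𝓡 R.dim) (𝓡 R'.dim) ∞ f :=
    (ContMDiff.iff_comp_isImmersion R'.isSmoothEmbedding.isImmersion).2
      ⟨hP.morphism.contMDiff_base.continuous.restrict hπ, hP.morphism.contMDiff_base.comp hι⟩
  have hmf : ∀ (x : S) (u : TangentSpace (𝓡 R.dim) x),
      mfderiv (𝓡 R'.dim) (𝓡 m') (Subtype.val : S' → Q') (f x)
        (mfderiv (𝓡 R.dim) (𝓡 R'.dim) f x u) =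
      mfderiv (𝓡 m) (𝓡 m') π (x : Q) (mfderiv (𝓡 R.dim) (𝓡 m) (Subtype.val : S → Q) x u) := by
    intro x u
    have h1 := mfderiv_comp_apply x (hι'.mdifferentiable (by simp) (f x))
      (hfs.mdifferentiable (by simp) x) u
    have h2 := mfderiv_comp_apply x
      (hP.morphism.contMDiff_base.mdifferentiable (by simp) (x : Q))
      (hι.mdifferentiable (by simp) x) u
    exact h1.symm.trans h2
  refine ⟨isLieAlgebroidMorphism_of_separating hfs ?_ ?_ ?_, ?_, ?_, ?_, ?_, ?_⟩
  · intro p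
    -- Smoothness into the subbundle is checked after the inclusion into `E'`, where the map is `P`
    -- composed with the inclusion of `K`.
    exact contMDiffAt_total_of_comp_injective (F := fun y : S' => (K' y).subtype)
      (g := fun p : TotalSpace (EuclideanSpace ℝ (Fin R.rank)) (fun x : S => K x) => f p.1)
      (W := fun p => (P p.1).restrict (hK p.1 p.1.2) p.2)
      R'.inclusion.contMDiff_total
      (hfs.contMDiffAt.comp p (Bundle.contMDiffAt_proj _))
      (Submodule.subtype_injective _)
      (hP.morphism.contMDiff_total.comp R.inclusion.contMDiff_total).contMDiffAt
  · intro x e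
    apply hinj
    rw [hmf, R.inclusion.mfderiv_anchor, hP.morphism.mfderiv_anchor, R'.inclusion.mfderiv_anchor]
    rfl
  · intro x e h
    -- The separating 1-forms are restrictions of the coordinate forms of a frame of the ambient
    -- `E'`. Each has a differential there, carried to `K` by the morphisms `P` and `R.inclusion`
    -- and to `K'` by `R'.inclusion`.
    obtain ⟨Z⟩ := SectionFrame.nonempty (m := m') (n := n') (E := E') (π x)
    refine Subtype.ext (Z.ext_coord fun b => ?_)
    have hs := FibreForm.isSmooth_ofDual_coord Z b
    obtain ⟨ψ, hψ, hd⟩ := A'.exists_isDifferential_one hs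
    have h1 := R.inclusion.differential 1 _ _
      (hs.pullback hP.morphism.contMDiff_base hP.morphism.contMDiff_total)
      (hψ.pullback hP.morphism.contMDiff_base hP.morphism.contMDiff_total)
      (hP.morphism.differential 1 _ ψ hs hψ hd)
    have h2 := h ((FibreForm.ofDual (Z.coord b)).restrict S' K') (ψ.restrict S' K')
      (hs.pullback R'.inclusion.contMDiff_base R'.inclusion.contMDiff_total)
      (R'.inclusion.differential 1 _ ψ hs hψ hd)
    exact (h2 ((congrArg₂ R.algebroid.IsDifferential (FibreForm.pullback_restrict _ hπ hK)
      (FibreForm.pullback_restrict ψ hπ hK)).mpr h1)).trans (map_zero _).symm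
  · rintro ⟨y, hy⟩
    obtain ⟨x, rfl⟩ := hP.surjective y
    exact ⟨⟨x, by rwa [hS]⟩, rfl⟩
  · intro x v'
    -- An ambient lift of a vector tangent to `S'` is tangent to `S`, because `S` is a full
    -- preimage; injectivity of the derivative of the inclusion of `S'` then identifies its image.
    obtain ⟨v, hv⟩ := hP.submersion x
      (mfderiv (𝓡 R'.dim) (𝓡 m') (Subtype.val : S' → Q') (f x) v')
    have hmem : v ∈ tangentTo m S (x : Q) := by
      have hx : π x ∈ S' := hπ x.2
      rw [congrArg (fun T => tangentTo m T (x : Q)) hS,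
        tangentTo_preimage hP.morphism.contMDiff_base (hP.submersion x) hx]
      change mfderiv (𝓡 m) (𝓡 m') π (x : Q) v ∈ tangentTo m' S' (f x : Q')
      rw [hv, tangentTo_eq_range R'.isSmoothEmbedding (f x)]
      exact ⟨v', rfl⟩
    rw [tangentTo_eq_range R.isSmoothEmbedding x] at hmem
    obtain ⟨u, rfl⟩ := hmem
    exact ⟨u, hinj _ ((hmf x u).trans hv)⟩
  · rintro x ⟨e', he'⟩
    obtain ⟨e, rfl⟩ := hP.fibre_surjective x e'
    exact ⟨⟨e, by rw [hKK' x x.2]; exact he'⟩, rfl⟩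
  · exact (FibreForm.pullback_restrict Ω' hπ hK).trans
      (congrArg (fun φ => FibreForm.restrict φ S K) hP.pullback_two)
  · exact (FibreForm.pullback_restrict α' hπ hK).trans
      (congrArg (fun φ => FibreForm.restrict φ S K) hP.pullback_one)

end IsDynamicalEpimorphism

end DynamicalEpimorphisms

end

/-! ### The theorem -/

theorem theorem3p2
    {m n m' n' : ℕ}
    {Q : Type*} [TopologicalSpace Q] [T2Space Q] [SecondCountableTopology Q]
    [ChartedSpace (EuclideanSpace ℝ (Fin m)) Q] [IsManifold (𝓡 m) ∞ Q]
    {E : Q → Type*} [∀ x, AddCommGroup (E x)] [∀ x, Module ℝ (E x)]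
    [∀ x, TopologicalSpace (E x)] [TopologicalSpace (TotalSpace (EuclideanSpace ℝ (Fin n)) E)]
    [FiberBundle (EuclideanSpace ℝ (Fin n)) E] [VectorBundle ℝ (EuclideanSpace ℝ (Fin n)) E]
    [ContMDiffVectorBundle ∞ (EuclideanSpace ℝ (Fin n)) E (𝓡 m)]
    {Q' : Type*} [TopologicalSpace Q'] [T2Space Q'] [SecondCountableTopology Q']
    [ChartedSpace (EuclideanSpace ℝ (Fin m')) Q'] [IsManifold (𝓡 m') ∞ Q']
    {E' : Q' → Type*} [∀ x, AddCommGroup (E' x)] [∀ x, Module ℝ (E' x)]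
    [∀ x, TopologicalSpace (E' x)]
    [TopologicalSpace (TotalSpace (EuclideanSpace ℝ (Fin n')) E')]
    [FiberBundle (EuclideanSpace ℝ (Fin n')) E'] [VectorBundle ℝ (EuclideanSpace ℝ (Fin n')) E']
    [ContMDiffVectorBundle ∞ (EuclideanSpace ℝ (Fin n')) E' (𝓡 m')]
    (A : LieAlgebroid m n E) (Ω : FibreForm E 2) (α : FibreForm E 1)
    (hA : IsPresymplecticSystem A Ω α)
    (A' : LieAlgebroid m' n' E') (Ω' : FibreForm E' 2) (α' : FibreForm E' 1)
    (hA' : IsPresymplecticSystem A' Ω' α')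
    -- both constraint algorithms produce sequences of Lie subalgebroids
    (R : ∀ k, LieSubalgebroid A (A.constraintSet Ω α k) (A.constraintFibre Ω α k))
    (R' : ∀ k, LieSubalgebroid A' (A'.constraintSet Ω' α' k) (A'.constraintFibre Ω' α' k))
    (π : Q → Q') (P : ∀ x, E x →ₗ[ℝ] E' (π x))
    (hP : IsDynamicalEpimorphism A Ω α A' Ω' α' π P) :
    -- the stages correspond
    (∀ k, π '' A.constraintSet Ω α k = A'.constraintSet Ω' α' k ∧
      (fun p : TotalSpace (EuclideanSpace ℝ (Fin n)) E =>
        (⟨π p.1, P p.1 p.2⟩ : TotalSpace (EuclideanSpace ℝ (Fin n')) E')) ''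
          A.constraintTotal Ω α k = A'.constraintTotal Ω' α' k) ∧
    -- saturation by the fibres of `π` and the kernel of `P`
    (∀ k, ∀ x ∈ A.constraintSet Ω α k,
      π ⁻¹' {π x} ⊆ A.constraintSet Ω α k ∧
      LinearMap.ker (P x) ≤ A.constraintFibre Ω α k x) ∧
    -- the restrictions are dynamical epimorphisms between the restricted presymplectic systems,
    -- and solutions correspond
    (∀ k, ∃ (hπ : MapsTo π (A.constraintSet Ω α k) (A'.constraintSet Ω' α' k))
      (hK : ∀ x ∈ A.constraintSet Ω α k, ∀ e ∈ A.constraintFibre Ω α k x,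
        P x e ∈ A'.constraintFibre Ω' α' k (π x)),
      IsPresymplecticSystem (R k).algebroid
        (Ω.restrict (A.constraintSet Ω α k) (A.constraintFibre Ω α k))
        (α.restrict (A.constraintSet Ω α k) (A.constraintFibre Ω α k)) ∧
      IsPresymplecticSystem (R' k).algebroid
        (Ω'.restrict (A'.constraintSet Ω' α' k) (A'.constraintFibre Ω' α' k))
        (α'.restrict (A'.constraintSet Ω' α' k) (A'.constraintFibre Ω' α' k)) ∧
      IsDynamicalEpimorphism
        (R k).algebroid
        (Ω.restrict (A.constraintSet Ω α k) (A.constraintFibre Ω α k))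
        (α.restrict (A.constraintSet Ω α k) (A.constraintFibre Ω α k))
        (R' k).algebroid
        (Ω'.restrict (A'.constraintSet Ω' α' k) (A'.constraintFibre Ω' α' k))
        (α'.restrict (A'.constraintSet Ω' α' k) (A'.constraintFibre Ω' α' k))
        (hπ.restrict π (A.constraintSet Ω α k) (A'.constraintSet Ω' α' k))
        (fun x => (P x).restrict (hK x x.2)) ∧
      -- a projectable section solves the first equation iff its projection solves the second
      (∀ (X : (R k).Sections) (X' : (R' k).Sections),
        (∀ x : A.constraintSet Ω α k, (X' ⟨π x, hπ x.2⟩ : E' (π x)) = P x (X x)) →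
        (SolvesAlong Ω α X ↔ SolvesAlong Ω' α' X')) ∧
      -- every solution of the second equation lifts to a solution of the first
      (∀ X' : (R' k).Sections, SolvesAlong Ω' α' X' →
        ∃ X : (R k).Sections,
          (∀ x : A.constraintSet Ω α k, (X' ⟨π x, hπ x.2⟩ : E' (π x)) = P x (X x)) ∧ SolvesAlong Ω α X)) ∧
    -- the two algorithms stabilize at the same step
    (∀ k, A.constraintSet Ω α k = A.constraintSet Ω α (k + 1) ↔
      A'.constraintSet Ω' α' k = A'.constraintSet Ω' α' (k + 1)) := by
  have hset := hP.constraintSet_eq_preimage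
  have hmaps : ∀ k, MapsTo π (A.constraintSet Ω α k) (A'.constraintSet Ω' α' k) := fun k x hx => by
    rwa [hset] at hx
  have hK : ∀ k, ∀ x ∈ A.constraintSet Ω α k, ∀ e ∈ A.constraintFibre Ω α k x,
      P x e ∈ A'.constraintFibre Ω' α' k (π x) := fun k x hx e he => by
    rwa [hP.constraintFibre_eq_comap hx] at he
  refine ⟨fun k => ⟨?_, hP.image_constraintTotal k⟩, fun k x hx => ⟨?_, ?_⟩,
    fun k => ⟨hmaps k, hK k, hA.pullback (R k).inclusion, hA'.pullback (R' k).inclusion, ?_⟩,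
    fun k => ?_⟩
  · rw [hset, image_preimage_eq _ hP.surjective]
  · rw [hset] at hx ⊢
    exact preimage_mono (singleton_subset_iff.2 hx)
  · rw [hP.constraintFibre_eq_comap hx]
    exact fun e he => Submodule.mem_comap.2 (by rw [LinearMap.mem_ker.1 he]; exact zero_mem _)
  · have hk := hP.restrict (hset k) (fun x hx => hP.constraintFibre_eq_comap hx) (R k) (R' k)
      (hmaps k) (hK k)
    refine ⟨hk, fun X X' h => hP.solvesAlong_iff (hset k) (hmaps k) h, fun X' hX' => ?_⟩
    obtain ⟨X, hX⟩ := exists_lift hk.morphism.contMDiff_total hk.morphism.contMDiff_base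
      hk.fibre_surjective X'
    have h : ∀ x : A.constraintSet Ω α k,
        (X' ⟨π x, hmaps k x.2⟩ : E' (π x)) = P x (X x) := fun x =>
      (congrArg Subtype.val (hX x)).symm
    exact ⟨X, h, (hP.solvesAlong_iff (hset k) (hmaps k) h).2 hX'⟩
  -- Taking preimages under a surjection is injective on subsets, so equality of stages can be
  -- tested downstairs.
  · rw [hset, hset, hP.surjective.preimage_injective.eq_iff]
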